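/- All spaces are finite-dimensional complex Hilbert spaces with fixed orthonormal (computational) bases, and $D(\mathcal X)$ is the set of density matrices on $\mathcal X$. For positive semidefinite $X,Y$ on $\mathcal X$, the fidelity is $F(X,Y)=\max|\langle\phi|\psi\rangle|$ over all purifications $|\phi\rangle$ of $X$ and $|\psi\rangle$ of $Y$ in $\mathcal X\otimes\mathcal Z$, with $\mathcal Z$ an arbitrary auxiliary space. Original circuits. Let $n\ge 1$ and let $Q_1,Q_2$ be quantum circuits from $\mathcal H$ to $\mathcal K$ of size $n$: $Q_1$ introduces an ancilla register $\mathcal A$ in a basis state $|0\rangle$, applies unitaries $U_1,\dots,U_n$ on $\mathcal H\otimes\mathcal A\cong\mathcal B\otimes\mathcal K$ in this order, and traces out $\mathcal B$, so $$Q_1(\rho)=\operatorname{tr}_{\mathcal B}\,U_n\cdots U_1(\rho\otimes|0\rangle\langle0|)U_1^*\cdots U_n^*;$$ $Q_2$ is given in the same way by $V_1,\dots,V_n$. Parallelized circuits. The parallelized version of $Q_1$ takes as input a (possibly entangled) state on registers $\mathcal H_1$ (the input of $U_1$, which is completed with an ancilla in state $|0\rangle$), $R_i\cong\mathcal H\otimes\mathcal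 A$ (the input of $U_i$) for $2\le i\le n$, and $S_i\cong\mathcal H\otimes\mathcal A$ (auxiliary) for $2\le i\le n$; let $R_1=\mathcal H_1\otimes\mathcal A_1$. For each $2\le i\le n$ a control qubit is prepared in the state $(|0\rangle+|1\rangle)/\sqrt2$. The circuit performs, in this order: 1. for each $i$, controlled on the $i$th control qubit, a swap test between $R_i$ and $S_i$; 2. a NOT gate on every control qubit; 3. all $U_1,\dots,U_n$ in parallel, $U_i$ acting on $R_i$; 4. for each $i$, controlled on the $i$th control qubit, a swap test between $R_{i-1}$ (now holding the output of $U_{i-1}$) and $S_i$. Each swap test has its own output qubit, initially $|0\rangle$; a performed swap test applies to it a Hadamard gate, a swap of the two registers controlled by it, and another Hadamard gate, while the output qubit of a test that is not performed stays $|0\rangle$. Finally the $2(n-1)$ output qubits of the swap tests are measured in the computational basis, and everything is traced out except these qubits and the space $\mathcal K$ of the output of $U_n$. The circuit $C_1$ outputs $2(n-1)$ dummy qubits in the state $|0\rangle$, the outputs of its swap tests, and the output of $U_n$, in this order; $C_2$ is built from $V_1,\dots,V_n$ in the same way, except that it outputs first the outputs of its swap tests, then the dummy qubits, then the output of $V_n$.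 Thus the swap-test outputs of each circuit are aligned with the dummy qubits of the other. Theorem. Let $c\ge 0$. If $F(Q_1(\rho_0),Q_2(\xi_0))<1-c$ for all $\rho_0,\xi_0\in D(\mathcal H)$, then $$F(C_1(\rho),C_2(\xi))<1-\frac{c^2}{144\,n^2}$$ for all $\rho,\xi\in D\big(\mathcal H\otimes(\mathcal H\otimes\mathcal A)^{\otimes(n-1)}\otimes(\mathcal H\otimes\mathcal A)^{\otimes(n-1)}\big)$. -/

import Mathlib

open scoped Matrix Kronecker ComplexOrder

set_option synthInstance.maxSize 2000
set_option synthInstance.maxHeartbeats 100000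

noncomputable section

namespace QCirc

/-! Operators on the finite dimensional Hilbert space with orthonormal basis `X` are matrices
`Matrix X X ℂ`; the tensor product of two spaces has basis `X × Y`. -/

section States

variable {X Y : Type*}

/-- Density matrices: positive semidefinite of trace one. -/
def IsDensity [Fintype X] (ρ : Matrix X X ℂ) : Prop :=
  ρ.PosSemidef ∧ ρ.trace = 1

/-- The partial trace over the left tensor factor. -/
def trLeft [Fintype X] (M : Matrix (X × Y) (X × Y) ℂ) : Matrix Y Y ℂ :=
  fun y y' => ∑ x, M (x, y) (x, y')

/-- The partial trace over the right tensor factor. -/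
def trRight [Fintype Y] (M : Matrix (X × Y) (X × Y) ℂ) : Matrix X X ℂ :=
  fun x x' => ∑ y, M (x, y) (x', y)

/-- The operator `|φ⟩⟨φ|`. -/
def proj (φ : X → ℂ) : Matrix X X ℂ :=
  Matrix.vecMulVec φ (star φ)

/-- The fidelity `F(P, R)`: the largest overlap `|⟨φ|ψ⟩|` of purifications `φ` of `P` and `ψ` of `R`
in `X ⊗ ℂᵈ`, where the dimension `d` of the purifying space is arbitrary. -/
def fidelity [Fintype X] (P R : Matrix X X ℂ) : ℝ :=
  sSup {r : ℝ | ∃ (d : ℕ) (φ ψ : X × Fin d → ℂ),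
    trRight (proj φ) = P ∧ trRight (proj ψ) = R ∧ r = ‖star φ ⬝ᵥ ψ‖}

/-- The evolution `ρ ↦ M ρ M*`. -/
def evolve [Fintype X] (M : Matrix Y X ℂ) (ρ : Matrix X X ℂ) : Matrix Y Y ℂ :=
  M * ρ * Mᴴ

/-- The operator that sends the basis vector `|x⟩` to the basis vector `|f x⟩`. -/
def basisMap [DecidableEq Y] (f : X → Y) : Matrix Y X ℂ :=
  fun y x => if y = f x then 1 else 0

/-- The tensor product `⨂ i, M i` of operators on copies of one space, indexed by `ι`. -/
def tensor {ι : Type*} [Fintype ι] (M : ι → Matrix X X ℂ) : Matrix (ι → X) (ι → X) ℂ :=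
  fun x y => ∏ i, M i (x i) (y i)

/-- Measurement of the first tensor factor in the computational basis, keeping the outcome. -/
def measureLeft [DecidableEq X] (σ : Matrix (X × Y) (X × Y) ℂ) : Matrix (X × Y) (X × Y) ℂ :=
  fun x y => if x.1 = y.1 then σ x y else 0

/-- The Hadamard gate on a qubit (`false` is `|0⟩`, `true` is `|1⟩`). -/
def hadamardGate : Matrix Bool Bool ℂ :=
  fun a b => (if a && b then -1 else 1) / ((Real.sqrt 2 : ℝ) : ℂ)

/-- The `X` (not) gate on a qubit. -/
def notGate : Matrix Bool Bool ℂ := basisMap not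

end States

/-- A quantum circuit from `H` to `K` made of `n` unitary pieces: the ancilla `A` is introduced in
the state `|0⟩`, the unitaries `U 0, …, U (n - 1)` are applied to `H ⊗ A` in this order, and finally
`B` is traced out, under the identification `split` of `H ⊗ A` with `B ⊗ K`. -/
structure Circuit (n : ℕ) (H A B K : Type*)
    [Fintype H] [DecidableEq H] [Fintype A] [DecidableEq A] where
  /-- the basis vector `|0⟩` of the ancilla space -/
  zero : A
  /-- the pieces of the circuit -/
  U : Fin n → Matrix.unitaryGroup (H × A) ℂ
  /-- the identification of `H ⊗ A` with `B ⊗ K` -/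
  split : H × A ≃ B × K

section Construction

variable {n m : ℕ} {H A B K : Type*}
  [Fintype H] [DecidableEq H] [Fintype A] [DecidableEq A] [Fintype B]

/-- The output state `Q(ρ)` of the circuit `Q` on the input state `ρ`. -/
def Circuit.run (Q : Circuit n H A B K) (ρ : Matrix H H ℂ) : Matrix K K ℂ :=
  let initial : Matrix (H × A) (H × A) ℂ := evolve (basisMap fun h => (h, Q.zero)) ρ
  let final := (List.ofFn Q.U).foldl (fun σ V => evolve (V : Matrix (H × A) (H × A) ℂ) σ) initial
  trLeft (final.submatrix Q.split.symm Q.split.symm)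

/-! ### The parallelized circuit

For a circuit with `m + 1` pieces there are `m` interfaces; interface `i` lies between piece
`i.castSucc` and piece `i.succ`. -/

/-- The input space of the parallelized circuit: the input in `H` of the first piece, the inputs in
`H ⊗ A` of the other `m` pieces, and for each interface an auxiliary input in `H ⊗ A`. -/
abbrev Input (m : ℕ) (H A : Type*) : Type _ :=
  H × (Fin m → H × A) × (Fin m → H × A)

/-- All the registers of the parallelized circuit: for each interface a control qubit, the output
qubit of the first swap test and the output qubit of the second swap test; for each piece the
register it acts on; and for each interface the auxiliary register. -/
abbrev Registers (m : ℕ) (H A : Type*) : Type _ :=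
  (Fin m → Bool) × (Fin m → Bool) × (Fin m → Bool) × (Fin (m + 1) → H × A) × (Fin m → H × A)

/-- The output qubits of the swap tests: first tests, second tests. -/
abbrev Tests (m : ℕ) : Type := (Fin m → Bool) × (Fin m → Bool)

/-- Introduce the ancilla of the first piece, the control qubits and the output qubits of the swap
tests, all in the state `|0⟩`. -/
def prepare (m : ℕ) (zero : A) : Matrix (Registers m H A) (Input m H A) ℂ :=
  basisMap fun x =>
    (fun _ => false, fun _ => false, fun _ => false, Fin.cons (x.1, zero) x.2.1, x.2.2)

/-- A Hadamard gate on each control qubit. -/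
def hadamardControls (m : ℕ) (H A : Type*)
    [Fintype H] [DecidableEq H] [Fintype A] [DecidableEq A] :
    Matrix (Registers m H A) (Registers m H A) ℂ :=
  tensor (fun _ => hadamardGate) ⊗ₖ 1

/-- A not gate on each control qubit. -/
def flipControls (m : ℕ) (H A : Type*)
    [Fintype H] [DecidableEq H] [Fintype A] [DecidableEq A] :
    Matrix (Registers m H A) (Registers m H A) ℂ :=
  tensor (fun _ => notGate) ⊗ₖ 1

/-- A Hadamard gate on the output qubit of each first swap test. -/
def hadamardFirst (m : ℕ) (H A : Type*)
    [Fintype H] [DecidableEq H] [Fintype A] [DecidableEq A] :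
    Matrix (Registers m H A) (Registers m H A) ℂ :=
  1 ⊗ₖ (tensor (fun _ => hadamardGate) ⊗ₖ 1)

/-- A Hadamard gate on the output qubit of each second swap test. -/
def hadamardSecond (m : ℕ) (H A : Type*)
    [Fintype H] [DecidableEq H] [Fintype A] [DecidableEq A] :
    Matrix (Registers m H A) (Registers m H A) ℂ :=
  1 ⊗ₖ (1 ⊗ₖ (tensor (fun _ => hadamardGate) ⊗ₖ 1))

/-- For each interface `i`, swap the register of the piece after the interface and the auxiliary
register, controlled by the control qubit and by the output qubit of the first test. -/
def controlledSwapFirst (m : ℕ) (H A : Type*)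
    [Fintype H] [DecidableEq H] [Fintype A] [DecidableEq A] :
    Matrix (Registers m H A) (Registers m H A) ℂ :=
  basisMap fun (c, t, u, R, S) =>
    (c, t, u,
      Fin.cons (R 0) (fun i => if c i && t i then S i else R i.succ),
      fun i => if c i && t i then R i.succ else S i)

/-- For each interface `i`, swap the register of the piece before the interface and the auxiliary
register, controlled by the control qubit and by the output qubit of the second test. -/
def controlledSwapSecond (m : ℕ) (H A : Type*)
    [Fintype H] [DecidableEq H] [Fintype A] [DecidableEq A] :
    Matrix (Registers m H A) (Registers m H A) ℂ :=
  basisMap fun (c, t, u, R, S) =>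
    (c, t, u,
      Fin.snoc (α := fun _ => H × A)
        (fun i => if c i && u i then S i else R i.castSucc) (R (Fin.last m)),
      fun i => if c i && u i then R i.castSucc else S i)

/-- The controlled first swap tests: the input of the next piece against the auxiliary input. -/
def firstSwapTests (m : ℕ) (H A : Type*)
    [Fintype H] [DecidableEq H] [Fintype A] [DecidableEq A] :
    Matrix (Registers m H A) (Registers m H A) ℂ :=
  hadamardFirst m H A * controlledSwapFirst m H A * hadamardFirst m H A

/-- The controlled second swap tests: the output of the previous piece against the auxiliary
input. -/
def secondSwapTests (m : ℕ) (H A : Type*)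
    [Fintype H] [DecidableEq H] [Fintype A] [DecidableEq A] :
    Matrix (Registers m H A) (Registers m H A) ℂ :=
  hadamardSecond m H A * controlledSwapSecond m H A * hadamardSecond m H A

/-- All the pieces of `Q` run in parallel, each on its own register. -/
def Circuit.pieces (Q : Circuit (m + 1) H A B K) :
    Matrix (Registers m H A) (Registers m H A) ℂ :=
  1 ⊗ₖ (1 ⊗ₖ (1 ⊗ₖ (tensor (fun j => (Q.U j : Matrix (H × A) (H × A) ℂ)) ⊗ₖ 1)))

/-- The unitary part of the parallelized circuit (operators act from right to left): at each
interface exactly one of the two swap tests is performed, depending on a control qubit that was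
put into an equal superposition. -/
def Circuit.parallelUnitary (Q : Circuit (m + 1) H A B K) :
    Matrix (Registers m H A) (Registers m H A) ℂ :=
  secondSwapTests m H A * Q.pieces * flipControls m H A * firstSwapTests m H A *
    hadamardControls m H A

/-- The registers arranged as (traced out) ⊗ ((outputs of the swap tests) ⊗ `K`), where `K` is the
output of the last piece. -/
def Circuit.arrange (Q : Circuit (m + 1) H A B K) :
    ((Fin m → Bool) × (Fin m → H × A) × B × (Fin m → H × A)) × (Tests m × K) → Registers m H A :=
  fun ((c, R, b, S), ((t, u), k)) =>
    (c, t, u, Fin.snoc (α := fun _ => H × A) R (Q.split.symm (b, k)), S)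

/-- The measured outputs of the swap tests and the output of the last piece of the parallelized
circuit on the input state `ρ`; everything else is traced out. -/
def Circuit.parallelRun (Q : Circuit (m + 1) H A B K)
    (ρ : Matrix (Input m H A) (Input m H A) ℂ) : Matrix (Tests m × K) (Tests m × K) ℂ :=
  let final := evolve Q.parallelUnitary (evolve (prepare m Q.zero) ρ)
  measureLeft (trLeft (final.submatrix Q.arrange Q.arrange))

/-- The state `|0⟩⟨0|` of the dummy qubits, one for each swap test of the other circuit. -/
def dummies (m : ℕ) : Matrix (Tests m) (Tests m) ℂ :=
  proj (Pi.single (fun _ => false, fun _ => false) 1)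

/-- The circuit `C₁` constructed from `Q₁`. Its outputs are dummy qubits, the outputs of its own
swap tests, and the output of its last piece. -/
def Circuit.constructed₁ (Q : Circuit (m + 1) H A B K)
    (ρ : Matrix (Input m H A) (Input m H A) ℂ) :
    Matrix (Tests m × Tests m × K) (Tests m × Tests m × K) ℂ :=
  dummies m ⊗ₖ Q.parallelRun ρ

/-- The circuit `C₂` constructed from `Q₂`. Its outputs are the outputs of its own swap tests, dummy
qubits, and the output of its last piece. -/
def Circuit.constructed₂ (Q : Circuit (m + 1) H A B K)
    (ξ : Matrix (Input m H A) (Input m H A) ℂ) :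
    Matrix (Tests m × Tests m × K) (Tests m × Tests m × K) ℂ :=
  (dummies m ⊗ₖ Q.parallelRun ξ).submatrix
    (fun x => (x.2.1, x.1, x.2.2)) (fun x => (x.2.1, x.1, x.2.2))

end Construction

end QCirc

end

/-!
Write `n = m + 1`, let `f` be the fidelity of the outputs of the original circuits on the
`H`-marginals of `ρ` and `ξ`, and let `r` be the overlap of arbitrary purifications of the outputs
of the constructed circuits. The core is the bound `1 - f ≤ 12 n √(1 - r)`
(`QCirc.fidelity_constructed_le`); as the hypothesis says that `c < 1 - f`, squaring gives the
theorem, with strict inequality.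

By a form of the Powers–Størmer inequality (`QCirc.exists_reflection_fidelity`) there is an
observable `S` with values `±1` on `K` whose expectations in the two original outputs differ by at
least `2 - 2 f`. Three estimates bound this difference from above.

*Between the outputs of the two constructed circuits.* By Cauchy–Schwarz, the expectations of `S`
in them differ by at most `2 √(1 - r²) ≤ 3 √(1 - r)` (`QCirc.expect_sub_sq_le`).

*Swap tests succeed.* The swap tests of each circuit are aligned with the dummy qubits of the other
one, so `r² ≤ p₁ p₂`, where `pᵢ` is the probability that all swap tests of the circuit `i` succeed
(`QCirc.norm_trace_sq_le_of_aligned`). Hence the failure probabilities `eᵢ = 1 - pᵢ` satisfy `e₁ +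
e₂ ≤ 2 (1 - r)`, and so `√e₁ + √e₂ ≤ 2 √(1 - r)`.

*Between each constructed circuit and its original*
(`QCirc.Circuit.abs_trace_parallelRun_sub_run_le`). If the swap tests fail with probability at most
`e`, then an observable with values `±1` has nearly the same expectation in the output of a piece
and in the input of the next piece, up to `12 √e` (`QCirc.IsReady.interface_le`). Pulling `S` back
through the pieces and adding up the errors at the `m` interfaces shows that the expectations of
`S` in the parallelized output and in the original output differ by at most `12 m √e`.

For a single interface, a successful swap test says that the state of two cells, on the branch
where the test is performed, is almost invariant under their exchange, so the two cells look alike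
to every observable on one cell (`QCirc.swap_test_sq_le`). The first test compares the auxiliary
cell with the input of the next piece, on one value of the control qubit; the second test compares
it with the output of the previous piece, on the other value. The two statements can be combined
because, in the Heisenberg picture, the control qubit is independent of the cells in question: the
initial state is fixed by the `X` gate of each control qubit and by the `Z` gate of each output
qubit of a test, and these symmetries make the cross terms vanish. The only effect of the first
test on the input of the next piece is to replace its state `σ` by `3/4 σ + 1/4 τ`, where `τ` is
the state of the auxiliary cell.

States are handled throughout as matrices `M : Matrix X E ℂ`, the purification of `M Mᴴ` by an
environment `E`, and the registers of the parallelized circuit as three families of qubits and one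
family of cells, each a copy of `H ⊗ A` (`QCirc.Cells`).
-/

set_option linter.unusedSectionVars false

noncomputable section

namespace QCirc

/-! ### Reflections and overlaps -/

section Overlap

variable {X Y J : Type*} [Fintype X] [Fintype Y] [Fintype J]

/-- An observable with values `±1`: a Hermitian unitary matrix. -/
structure IsReflection [DecidableEq X] (O : Matrix X X ℂ) : Prop where
  conjTranspose_eq : Oᴴ = O
  mul_self : O * O = 1

/-- The Cauchy–Schwarz inequality for the Hilbert–Schmidt inner product. -/
lemma norm_trace_conjTranspose_mul_sq_le (M N : Matrix X J ℂ) :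
    ‖(Mᴴ * N).trace‖ ^ 2 ≤ (Mᴴ * M).trace.re * (Nᴴ * N).trace.re := by
  have key (M N : Matrix X J ℂ) : (Mᴴ * N).trace =
      inner ℂ (WithLp.toLp 2 fun p : J × X => M p.2 p.1 : EuclideanSpace ℂ (J × X))
        (WithLp.toLp 2 fun p : J × X => N p.2 p.1) := by
    simp [Matrix.trace, Matrix.mul_apply, PiLp.inner_apply, Fintype.sum_prod_type, mul_comm]
  have hre : ∀ v : EuclideanSpace ℂ (J × X), (inner ℂ v v).re = ‖v‖ ^ 2 := fun v =>
    (norm_sq_eq_re_inner (𝕜 := ℂ) v).symm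
  rw [key M N, key M M, key N N, hre, hre, ← mul_pow]
  exact pow_le_pow_left₀ (norm_nonneg _) (norm_inner_le_norm _ _) 2

lemma trace_conjTranspose_mul_self_nonneg (M : Matrix X J ℂ) : 0 ≤ (Mᴴ * M).trace.re :=
  (Complex.le_def.1 (Matrix.posSemidef_conjTranspose_mul_self M).trace_nonneg).1

lemma re_trace_conjTranspose_mul_comm (M N : Matrix X J ℂ) :
    (Mᴴ * N).trace.re = (Nᴴ * M).trace.re := by
  have h : (Mᴴ * N).trace = star (Nᴴ * M).trace := by
    rw [← Matrix.trace_conjTranspose, Matrix.conjTranspose_mul, Matrix.conjTranspose_conjTranspose]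
  rw [h]; simp

lemma re_trace_sub_sq (M N : Matrix X J ℂ) :
    ((M - N)ᴴ * (M - N)).trace.re =
      (Mᴴ * M).trace.re + (Nᴴ * N).trace.re - 2 * (Mᴴ * N).trace.re := by
  have h := re_trace_conjTranspose_mul_comm M N
  simp only [Matrix.conjTranspose_sub, Matrix.sub_mul, Matrix.mul_sub, Matrix.trace_sub,
    Complex.sub_re]
  linarith

lemma re_trace_add_sq (M N : Matrix X J ℂ) :
    ((M + N)ᴴ * (M + N)).trace.re =
      (Mᴴ * M).trace.re + (Nᴴ * N).trace.re + 2 * (Mᴴ * N).trace.re := by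
  have h := re_trace_conjTranspose_mul_comm M N
  simp only [Matrix.conjTranspose_add, Matrix.add_mul, Matrix.mul_add, Matrix.trace_add,
    Complex.add_re]
  linarith

/-- The expectation of a `±1`-valued observable is continuous in the state vector:
`⟨x|O|x⟩ - ⟨y|O|y⟩` is the real part of `⟨x - y|O|x + y⟩`. -/
lemma IsReflection.sub_sq_le [DecidableEq X] {O : Matrix X X ℂ} (hO : IsReflection O)
    (M N : Matrix X J ℂ) :
    ((Mᴴ * O * M).trace.re - (Nᴴ * O * N).trace.re) ^ 2 ≤
      ((M - N)ᴴ * (M - N)).trace.re * ((M + N)ᴴ * (M + N)).trace.re := by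
  have h1 := norm_trace_conjTranspose_mul_sq_le (M - N) (O * (M + N))
  have h2 : (O * (M + N))ᴴ * (O * (M + N)) = (M + N)ᴴ * (M + N) := by
    rw [Matrix.conjTranspose_mul, hO.conjTranspose_eq, Matrix.mul_assoc, ← Matrix.mul_assoc O O,
      hO.mul_self, Matrix.one_mul]
  have h3 : ((M - N)ᴴ * (O * (M + N))).trace.re =
      (Mᴴ * O * M).trace.re - (Nᴴ * O * N).trace.re := by
    have h := re_trace_conjTranspose_mul_comm M (O * N)
    rw [Matrix.conjTranspose_mul, hO.conjTranspose_eq] at h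
    simp only [Matrix.conjTranspose_sub, Matrix.sub_mul, Matrix.mul_add, Matrix.trace_sub,
      Matrix.trace_add, Complex.sub_re, Complex.add_re, Matrix.mul_assoc] at h ⊢
    linarith
  rw [h2] at h1
  rw [← h3]
  refine le_trans ?_ h1
  rw [← sq_abs]
  exact pow_le_pow_left₀ (abs_nonneg _) (Complex.abs_re_le_norm _) 2

/-! ### Fidelity -/

/-- A vector of `X ⊗ ℂᵈ` is an `X × d` matrix `M`, and it purifies `M Mᴴ`. -/
lemma trRight_proj {Z : Type*} (φ : Z × J → ℂ) :
    trRight (proj φ) = Matrix.of (fun x j => φ (x, j)) * (Matrix.of fun x j => φ (x, j))ᴴ := by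
  ext x y
  simp [trRight, proj, Matrix.vecMulVec_apply, Matrix.mul_apply]

lemma star_dotProduct_eq_trace (φ ψ : X × J → ℂ) :
    star φ ⬝ᵥ ψ =
      ((Matrix.of fun x j => φ (x, j))ᴴ * (Matrix.of fun x j => ψ (x, j))).trace := by
  simp only [dotProduct, Fintype.sum_prod_type, Matrix.trace, Matrix.diag, Matrix.mul_apply]
  rw [Finset.sum_comm]
  simp

lemma fidelity_le {P R : Matrix X X ℂ} {b : ℝ} (hb : 0 ≤ b)
    (h : ∀ (d : ℕ) (M N : Matrix X (Fin d) ℂ), M * Mᴴ = P → N * Nᴴ = R →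
      ‖(Mᴴ * N).trace‖ ≤ b) : fidelity P R ≤ b := by
  refine Real.sSup_le ?_ hb
  rintro r ⟨d, φ, ψ, h1, h2, rfl⟩
  rw [trRight_proj] at h1 h2
  rw [star_dotProduct_eq_trace]
  exact h d _ _ h1 h2

lemma norm_trace_sq_le_of_purifications {P R : Matrix X X ℂ} {M N : Matrix X J ℂ}
    (hM : M * Mᴴ = P) (hN : N * Nᴴ = R) :
    ‖(Mᴴ * N).trace‖ ^ 2 ≤ P.trace.re * R.trace.re := by
  have h := norm_trace_conjTranspose_mul_sq_le M N
  rwa [Matrix.trace_mul_comm Mᴴ M, Matrix.trace_mul_comm Nᴴ N, hM, hN] at h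

lemma le_fidelity (M N : Matrix X J ℂ) :
    ‖(Mᴴ * N).trace‖ ≤ fidelity (M * Mᴴ) (N * Nᴴ) := by
  let e := (Fintype.equivFin J).symm
  refine le_csSup ⟨√((M * Mᴴ).trace.re * (N * Nᴴ).trace.re), ?_⟩
    ⟨Fintype.card J, fun p => M p.1 (e p.2), fun p => N p.1 (e p.2), ?_, ?_, ?_⟩
  · rintro r ⟨d, φ, ψ, h1, h2, rfl⟩
    rw [trRight_proj] at h1 h2
    rw [star_dotProduct_eq_trace]
    exact Real.le_sqrt_of_sq_le (norm_trace_sq_le_of_purifications h1 h2)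
  · ext x y
    simp only [trRight, proj, Matrix.vecMulVec_apply, Matrix.mul_apply, Matrix.conjTranspose_apply]
    exact Equiv.sum_comp e fun j => M x j * star (M y j)
  · ext x y
    simp only [trRight, proj, Matrix.vecMulVec_apply, Matrix.mul_apply, Matrix.conjTranspose_apply]
    exact Equiv.sum_comp e fun j => N x j * star (N y j)
  · congr 1
    simp only [dotProduct, Fintype.sum_prod_type, Matrix.trace, Matrix.diag, Matrix.mul_apply,
      Matrix.conjTranspose_apply, Pi.star_apply]
    rw [Finset.sum_comm]
    exact Finset.sum_congr rfl fun x _ => (Equiv.sum_comp e fun j => star (M x j) * N x j).symm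

lemma fidelity_nonneg (P R : Matrix X X ℂ) : 0 ≤ fidelity P R := by
  refine Real.sSup_nonneg ?_
  rintro r ⟨d, φ, ψ, -, -, rfl⟩
  exact norm_nonneg _

open scoped MatrixOrder in
lemma exists_posSemidef_sqrt [DecidableEq X] {A : Matrix X X ℂ} (hA : A.PosSemidef) :
    ∃ R : Matrix X X ℂ, R.PosSemidef ∧ R * R = A :=
  ⟨CFC.sqrt A, Matrix.nonneg_iff_posSemidef.1 (CFC.sqrt_nonneg A),
    CFC.sqrt_mul_sqrt_self A (Matrix.nonneg_iff_posSemidef.2 hA)⟩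

/-- The sign of the Hermitian matrix `R - T` is a reflection whose product with `R - T` dominates
the square of `R - T` when tested against `R + T`, for positive semidefinite `R` and `T`. -/
lemma exists_reflection_trace_sq_sub [DecidableEq X] {R T : Matrix X X ℂ} (hR : R.PosSemidef)
    (hT : T.PosSemidef) :
    ∃ S : Matrix X X ℂ, IsReflection S ∧
      ((R - T) * (R - T)).trace.re ≤ (S * (R * R - T * T)).trace.re := by
  have hD : (R - T).IsHermitian := hR.1.sub hT.1
  set V : Matrix X X ℂ := (hD.eigenvectorUnitary : Matrix X X ℂ) with hV
  set l := hD.eigenvalues with hl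
  have hVV : Vᴴ * V = 1 := Unitary.coe_star_mul_self hD.eigenvectorUnitary
  have hVV' : V * Vᴴ = 1 := Unitary.coe_mul_star_self hD.eigenvectorUnitary
  have hspec : R - T = V * Matrix.diagonal (fun k => (l k : ℂ)) * Vᴴ := hD.spectral_theorem
  let s : X → ℝ := fun k => if 0 ≤ l k then 1 else -1
  have hss : ∀ k, s k * s k = 1 := fun k => by simp only [s]; split_ifs <;> norm_num
  have hsl : ∀ k, s k * l k = |l k| := fun k => by
    simp only [s]; split_ifs with h
    · simp [abs_of_nonneg h]
    · simp [abs_of_neg (not_le.1 h)]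
  let Sg : Matrix X X ℂ := V * Matrix.diagonal (fun k => (s k : ℂ)) * Vᴴ
  have conj_mul : ∀ a b : X → ℂ, V * Matrix.diagonal a * Vᴴ * (V * Matrix.diagonal b * Vᴴ) =
      V * Matrix.diagonal (fun k => a k * b k) * Vᴴ := fun a b => by
    calc _ = V * Matrix.diagonal a * (Vᴴ * V) * Matrix.diagonal b * Vᴴ := by
          simp only [Matrix.mul_assoc]
      _ = _ := by rw [hVV, Matrix.mul_one, Matrix.mul_assoc V, Matrix.diagonal_mul_diagonal]
  have hSD : Sg * (R - T) = V * Matrix.diagonal (fun k => ((|l k| : ℝ) : ℂ)) * Vᴴ := by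
    rw [hspec, conj_mul]
    simp only [← Complex.ofReal_mul, hsl]
  have hDS : (R - T) * Sg = V * Matrix.diagonal (fun k => ((|l k| : ℝ) : ℂ)) * Vᴴ := by
    rw [hspec, conj_mul]
    simp only [← Complex.ofReal_mul, mul_comm (l _), hsl]
  refine ⟨Sg, ⟨?_, ?_⟩, ?_⟩
  · simp only [Sg, Matrix.conjTranspose_mul, Matrix.conjTranspose_conjTranspose,
      Matrix.diagonal_conjTranspose, Matrix.mul_assoc]
    congr; ext; simp
  · simp only [Sg]
    rw [conj_mul]
    simp only [← Complex.ofReal_mul, hss]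
    simp [hVV']
  · -- `R² - T²` is the symmetrized product of `R - T` and `R + T`
    have e1 : (Sg * (R * R - T * T)).trace = (Sg * (R - T) * (R + T)).trace := by
      have h1 : (2 : ℂ) * (Sg * (R * R - T * T)).trace =
          (Sg * ((R - T) * (R + T))).trace + (Sg * ((R + T) * (R - T))).trace := by
        rw [← Matrix.trace_add, ← Matrix.mul_add,
          show (R - T) * (R + T) + (R + T) * (R - T) = (2 : ℂ) • (R * R - T * T) by
            rw [two_smul]; noncomm_ring, Matrix.mul_smul, Matrix.trace_smul, smul_eq_mul]
      have h2 : (Sg * ((R + T) * (R - T))).trace = (Sg * (R - T) * (R + T)).trace := by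
        rw [← Matrix.mul_assoc, Matrix.trace_mul_comm, ← Matrix.mul_assoc, hDS, hSD]
      rw [h2, ← Matrix.mul_assoc] at h1
      linear_combination h1 / 2
    have diag_tr : ∀ (a : X → ℂ) (N : Matrix X X ℂ),
        (V * Matrix.diagonal a * Vᴴ * N).trace = ∑ k, a k * (Vᴴ * N * V) k k := fun a N => by
      rw [Matrix.mul_assoc, Matrix.mul_assoc, Matrix.trace_mul_comm, Matrix.mul_assoc]
      simp [Matrix.trace, Matrix.diagonal_mul]
    have e2 : ((R - T) * (R - T)).trace.re = ∑ k, |l k| * |l k| := by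
      rw [hspec, conj_mul, ← Matrix.mul_one (V * _ * _), diag_tr]
      simp [hVV]
    have hdiag : Vᴴ * (R - T) * V = Matrix.diagonal (fun k => (l k : ℂ)) := by
      rw [hspec]
      calc _ = (Vᴴ * V) * Matrix.diagonal (fun k => (l k : ℂ)) * (Vᴴ * V) := by
            simp only [Matrix.mul_assoc]
        _ = _ := by simp [hVV]
    rw [e1, e2, hSD, diag_tr, Complex.re_sum]
    refine Finset.sum_le_sum fun k _ => ?_
    rw [Complex.re_ofReal_mul]
    refine mul_le_mul_of_nonneg_left ?_ (abs_nonneg _)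
    have p1 := (Complex.le_def.1 ((hR.conjTranspose_mul_mul_same V).diag_nonneg (i := k))).1
    have p2 := (Complex.le_def.1 ((hT.conjTranspose_mul_mul_same V).diag_nonneg (i := k))).1
    have p3 : (Vᴴ * R * V) k k - (Vᴴ * T * V) k k = l k := by
      have := congrFun (congrFun hdiag k) k
      simpa [Matrix.mul_sub, Matrix.sub_mul] using this
    have p4 : (Vᴴ * (R + T) * V) k k = (Vᴴ * R * V) k k + (Vᴴ * T * V) k k := by
      simp [Matrix.mul_add, Matrix.add_mul]
    have p5 := congrArg Complex.re p3
    rw [p4]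
    simp only [Complex.add_re, Complex.sub_re, Complex.ofReal_re, Complex.zero_re] at p1 p2 p5 ⊢
    rw [abs_le]
    constructor <;> linarith

/-- A form of the Powers–Størmer inequality: a `±1`-valued observable distinguishes two states at
least as well as their fidelity allows. -/
lemma exists_reflection_fidelity [DecidableEq X] {A B : Matrix X X ℂ} (hA : IsDensity A)
    (hB : IsDensity B) :
    ∃ S : Matrix X X ℂ, IsReflection S ∧
      2 - 2 * fidelity A B ≤ (S * A).trace.re - (S * B).trace.re := by
  obtain ⟨R, hR, rfl⟩ := exists_posSemidef_sqrt hA.1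
  obtain ⟨T, hT, rfl⟩ := exists_posSemidef_sqrt hB.1
  obtain ⟨S, hS, h⟩ := exists_reflection_trace_sq_sub hR hT
  refine ⟨S, hS, ?_⟩
  have h1 := le_fidelity R T
  rw [hR.1.eq, hT.1.eq] at h1
  have h2 := (Complex.re_le_norm _).trans h1
  have h3 := re_trace_sub_sq R T
  rw [Matrix.conjTranspose_sub, hR.1.eq, hT.1.eq, hA.2, hB.2, Complex.one_re] at h3
  rw [Matrix.mul_sub S, Matrix.trace_sub, Complex.sub_re] at h
  linarith

end Overlap

/-! ### Tensor products of local operators -/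

section Tensor

variable {X Y Z ι : Type*} [Fintype X] [DecidableEq X] [Fintype ι] [DecidableEq ι]

lemma tensor_mul (M N : ι → Matrix X X ℂ) : tensor M * tensor N = tensor fun i => M i * N i := by
  ext x y
  simp only [tensor, Matrix.mul_apply, Finset.prod_univ_sum, Fintype.piFinset_univ,
    Finset.prod_mul_distrib]

lemma tensor_one : tensor (fun _ : ι => (1 : Matrix X X ℂ)) = 1 := by
  ext x y
  simp only [tensor, Matrix.one_apply, Finset.prod_ite_zero, Finset.prod_const_one, funext_iff,
    Finset.mem_univ, true_imp_iff]

lemma tensor_conjTranspose (M : ι → Matrix X X ℂ) : (tensor M)ᴴ = tensor fun i => (M i)ᴴ := by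
  ext x y
  simp [tensor, Matrix.conjTranspose_apply]

/-- The operator `O` acting on the tensor factor `q`. -/
def atSite (q : ι) (O : Matrix X X ℂ) : Matrix (ι → X) (ι → X) ℂ :=
  tensor (Function.update (fun _ => 1) q O)

lemma tensor_mul_atSite {M : ι → Matrix X X ℂ} {q : ι} {O O' : Matrix X X ℂ}
    (h : M q * O = O' * M q) : tensor M * atSite q O = atSite q O' * tensor M := by
  simp only [atSite, tensor_mul]
  congr 1
  ext1 i
  by_cases hi : i = q
  · subst hi; simpa using h
  · simp [hi]

lemma atSite_mul (q : ι) (O O' : Matrix X X ℂ) : atSite q O * atSite q O' = atSite q (O * O') := by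
  simp only [atSite, tensor_mul]
  congr 1
  ext1 i
  by_cases hi : i = q
  · subst hi; simp
  · simp [hi]

lemma atSite_mul_comm {q r : ι} (hqr : q ≠ r) (O O' : Matrix X X ℂ) :
    atSite q O * atSite r O' = atSite r O' * atSite q O :=
  tensor_mul_atSite (by simp [Function.update_of_ne hqr.symm])

lemma atSite_one (q : ι) : atSite q (1 : Matrix X X ℂ) = 1 := by
  rw [atSite, Function.update_eq_self_iff.2 rfl, tensor_one]

lemma atSite_neg (q : ι) (O : Matrix X X ℂ) : atSite q (-O) = -atSite q O := by
  ext x y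
  simp only [atSite, tensor, Matrix.neg_apply]
  rw [Fintype.prod_eq_mul_prod_compl q, Fintype.prod_eq_mul_prod_compl q, ← neg_mul]
  congr 1
  · simp
  · refine Finset.prod_congr rfl fun i hi => ?_
    have : i ≠ q := by simpa using hi
    simp [this]

lemma atSite_conjTranspose (q : ι) (O : Matrix X X ℂ) : (atSite q O)ᴴ = atSite q Oᴴ := by
  simp only [atSite, tensor_conjTranspose]
  congr 1
  ext1 i
  by_cases hi : i = q
  · subst hi; simp
  · simp [hi]

lemma atSite_apply (q : ι) (O : Matrix X X ℂ) (x y : ι → X) :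
    atSite q O x y = if ∀ i, i ≠ q → x i = y i then O (x q) (y q) else 0 := by
  rw [atSite, tensor, Fintype.prod_eq_mul_prod_compl q, Function.update_self]
  rw [Finset.prod_congr rfl (g := fun i => if x i = y i then (1 : ℂ) else 0)]
  · simp only [Finset.prod_ite_zero, Finset.prod_const_one, Finset.mem_compl,
      Finset.mem_singleton, mul_ite, mul_one, mul_zero]
  · intro i hi
    have : i ≠ q := by simpa using hi
    simp [this, Matrix.one_apply]

lemma atSite_diagonal (q : ι) (d : X → ℂ) :
    atSite q (Matrix.diagonal d) = Matrix.diagonal fun x => d (x q) := by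
  ext x y
  rw [atSite_apply, Matrix.diagonal_apply, Matrix.diagonal_apply]
  by_cases h : x = y
  · simp [h]
  · rw [if_neg h]
    split_ifs with h1 h2
    · exact absurd (funext fun i => if hi : i = q then hi ▸ h2 else h1 i hi) h
    · rfl
    · rfl

/-- Relabelling the tensor factors along an involution. -/
lemma atSite_comp {f : ι → ι} (hf : Function.Involutive f) (q : ι) (O : Matrix X X ℂ)
    (x y : ι → X) : atSite q O (x ∘ f) (y ∘ f) = atSite (f q) O x y := by
  rw [atSite_apply, atSite_apply]
  refine if_congr ⟨fun h i hi => ?_, fun h i hi => h _ fun h' => hi (hf.injective h')⟩ rfl rfl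
  have := h (f i) fun h' => hi (by rw [← h', hf])
  simpa [hf i] using this

lemma tensor_isometry_conj_atSite {M : ι → Matrix X X ℂ} (hM : ∀ i, (M i)ᴴ * M i = 1) (q : ι)
    (O : Matrix X X ℂ) :
    (tensor M)ᴴ * atSite q O * tensor M = atSite q ((M q)ᴴ * O * M q) := by
  simp only [atSite, tensor_conjTranspose, tensor_mul]
  congr 1
  ext1 i
  by_cases hi : i = q
  · subst hi; simp
  · simp [hi, hM]

end Tensor

/-! ### Permutation operators -/

section BasisMap

variable {X Y Z : Type*} [DecidableEq X] [DecidableEq Y]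

lemma basisMap_mul_basisMap [DecidableEq Z] [Fintype Y] (f : Y → Z) (g : X → Y) :
    basisMap f * basisMap g = basisMap (f ∘ g) := by
  ext z x
  simp [basisMap, Matrix.mul_apply]

lemma basisMap_id : basisMap (id : X → X) = 1 := by
  ext x y
  simp [basisMap, Matrix.one_apply]

lemma basisMap_conjTranspose {f : X → X} (hf : Function.Involutive f) :
    (basisMap f)ᴴ = basisMap f := by
  ext x y
  simp only [basisMap, Matrix.conjTranspose_apply]
  rw [apply_ite star, star_one, star_zero]
  exact if_congr ⟨fun h => by rw [h, hf], fun h => by rw [h, hf]⟩ rfl rfl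

lemma basisMap_conj [Fintype X] {f : X → X} (hf : Function.Involutive f) (A : Matrix X X ℂ) :
    basisMap f * A * basisMap f = A.submatrix f f := by
  ext x y
  have h : ∀ z, x = f z ↔ z = f x := fun z => ⟨fun h => by rw [h, hf], fun h => by rw [h, hf]⟩
  simp [basisMap, Matrix.mul_apply, h]

lemma basisMap_kronecker (f : X → X) (g : Y → Y) :
    basisMap f ⊗ₖ basisMap g = basisMap (Prod.map f g) := by
  ext x y
  simp only [basisMap, Matrix.kroneckerMap_apply, Prod.ext_iff, Prod.map_fst, Prod.map_snd]
  split_ifs <;> simp_all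

end BasisMap

/-! ### Single qubit gates -/

/-- The `Z` gate on a qubit. -/
def signGate : Matrix Bool Bool ℂ := Matrix.diagonal fun b => if b then -1 else 1

lemma sqrt_two_mul_self : ((Real.sqrt 2 : ℝ) : ℂ) * ((Real.sqrt 2 : ℝ) : ℂ) = 2 := by
  rw [← Complex.ofReal_mul, Real.mul_self_sqrt (by norm_num)]; norm_num

lemma hadamardGate_mul_self : hadamardGate * hadamardGate = 1 := by
  ext a b
  cases a <;> cases b <;>
    simp only [hadamardGate, Matrix.mul_apply, Fintype.sum_bool, div_mul_div_comm,
      sqrt_two_mul_self] <;> norm_num [Matrix.one_apply]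

lemma hadamardGate_conjTranspose : hadamardGateᴴ = hadamardGate := by
  ext a b
  cases a <;> cases b <;> simp [hadamardGate, Matrix.conjTranspose_apply]

lemma hadamardGate_mul_signGate : hadamardGate * signGate = notGate * hadamardGate := by
  ext a b
  cases a <;> cases b <;>
    simp [hadamardGate, signGate, notGate, basisMap, Matrix.mul_apply, Matrix.diagonal_apply] <;>
    ring

lemma notGate_mul_self : notGate * notGate = 1 := by
  rw [notGate, basisMap_mul_basisMap, ← basisMap_id]
  congr 1
  funext b; simp

lemma notGate_conjTranspose : notGateᴴ = notGate := basisMap_conjTranspose Bool.not_not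

lemma signGate_mul_self : signGate * signGate = 1 := by
  ext a b
  cases a <;> cases b <;> simp [signGate, Matrix.mul_apply, Matrix.diagonal_apply]

lemma signGate_conjTranspose : signGateᴴ = signGate := by
  ext a b
  cases a <;> cases b <;> simp [signGate, Matrix.conjTranspose_apply]

lemma notGate_mul_signGate : notGate * signGate = (-signGate) * notGate := by
  ext a b
  cases a <;> cases b <;>
    simp [signGate, notGate, basisMap, Matrix.mul_apply, Matrix.diagonal_apply]

section Qubits

variable {ι : Type*} [Fintype ι] [DecidableEq ι]

/-- A Hadamard gate on every qubit of a family. -/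
def hadamards (ι : Type*) [Fintype ι] : Matrix (ι → Bool) (ι → Bool) ℂ :=
  tensor fun _ => hadamardGate

/-- A not gate on every qubit of a family. -/
def nots (ι : Type*) [Fintype ι] : Matrix (ι → Bool) (ι → Bool) ℂ :=
  tensor fun _ => notGate

/-- The `Z` gate on the qubit `i` of a family. -/
def signAt (i : ι) : Matrix (ι → Bool) (ι → Bool) ℂ := atSite i signGate

/-- The `X` gate on the qubit `i` of a family. -/
def notAt (i : ι) : Matrix (ι → Bool) (ι → Bool) ℂ := atSite i notGate

lemma hadamards_mul_self : hadamards ι * hadamards ι = 1 := by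
  simp only [hadamards, tensor_mul, hadamardGate_mul_self, tensor_one]

lemma hadamards_conjTranspose : (hadamards ι)ᴴ = hadamards ι := by
  simp only [hadamards, tensor_conjTranspose, hadamardGate_conjTranspose]

lemma nots_mul_self : nots ι * nots ι = 1 := by
  simp only [nots, tensor_mul, notGate_mul_self, tensor_one]

lemma nots_conjTranspose : (nots ι)ᴴ = nots ι := by
  simp only [nots, tensor_conjTranspose, notGate_conjTranspose]

lemma signAt_conjTranspose (i : ι) : (signAt i)ᴴ = signAt i := by
  rw [signAt, atSite_conjTranspose, signGate_conjTranspose]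

lemma notAt_conjTranspose (i : ι) : (notAt i)ᴴ = notAt i := by
  rw [notAt, atSite_conjTranspose, notGate_conjTranspose]

lemma signAt_mul_self (i : ι) : signAt i * signAt i = 1 := by
  rw [signAt, atSite_mul, signGate_mul_self, atSite_one]

lemma hadamards_conj_signAt (i : ι) : hadamards ι * signAt i * hadamards ι = notAt i := by
  rw [hadamards, signAt, tensor_mul_atSite hadamardGate_mul_signGate, Matrix.mul_assoc]
  change _ * (hadamards ι * hadamards ι) = _
  rw [hadamards_mul_self, Matrix.mul_one, notAt]

lemma hadamards_conj_notAt (i : ι) : hadamards ι * notAt i * hadamards ι = signAt i := by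
  rw [← hadamards_conj_signAt, ← Matrix.mul_assoc, ← Matrix.mul_assoc, hadamards_mul_self,
    Matrix.one_mul, Matrix.mul_assoc, hadamards_mul_self, Matrix.mul_one]

lemma nots_conj_signAt (i : ι) : nots ι * signAt i * nots ι = -signAt i := by
  rw [nots, signAt, tensor_mul_atSite (M := fun _ => notGate) notGate_mul_signGate,
    Matrix.mul_assoc]
  change _ * (nots ι * nots ι) = _
  rw [nots_mul_self, Matrix.mul_one, atSite_neg]

lemma notAt_conj_signAt (i : ι) : notAt i * signAt i * notAt i = -signAt i := by
  rw [notAt, signAt, atSite_mul, atSite_mul, notGate_mul_signGate, Matrix.mul_assoc,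
    notGate_mul_self, Matrix.mul_one, atSite_neg]

lemma signAt_conj_notAt (i : ι) : signAt i * notAt i * signAt i = -notAt i := by
  rw [notAt, signAt, atSite_mul, atSite_mul, Matrix.mul_assoc, notGate_mul_signGate,
    ← Matrix.mul_assoc, Matrix.mul_neg, signGate_mul_self, Matrix.neg_mul, Matrix.one_mul,
    atSite_neg]

lemma signAt_eq_diagonal (i : ι) :
    signAt i = Matrix.diagonal fun c : ι → Bool => if c i then (-1 : ℂ) else 1 := by
  rw [signAt, signGate, atSite_diagonal]

lemma signAt_apply (i : ι) (c c' : ι → Bool) :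
    signAt i c c' = if c = c' then (if c i then (-1 : ℂ) else 1) else 0 := by
  rw [signAt_eq_diagonal, Matrix.diagonal_apply]

lemma notAt_eq_basisMap (i : ι) :
    notAt i = basisMap fun c : ι → Bool => Function.update c i (!c i) := by
  ext c c'
  rw [notAt, atSite_apply]
  simp only [notGate, basisMap, Function.eq_update_iff]
  by_cases h : ∀ k, k ≠ i → c k = c' k
  · rw [if_pos h]
    exact if_congr (and_iff_left h).symm rfl rfl
  · rw [if_neg h, if_neg fun h' => h h'.2]

end Qubits

/-! ### Exchanging cells -/

section Exchange

variable {ι J : Type*} [DecidableEq ι] [DecidableEq J] {s : ι → J}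

/-- The permutation of the cells `J ⊕ ι` that exchanges the cells `s i` and `i`, for all `i` with
`b i`. It is a permutation when `s` is injective. -/
def exchange (s : ι → J) (b : ι → Bool) : J ⊕ ι → J ⊕ ι :=
  Sum.elim (Function.extend s (fun i => if b i then Sum.inr i else Sum.inl (s i)) Sum.inl)
    fun i => if b i then Sum.inl (s i) else Sum.inr i

lemma exchange_inl_apply (hs : s.Injective) (b : ι → Bool) (i : ι) :
    exchange s b (Sum.inl (s i)) = if b i then Sum.inr i else Sum.inl (s i) := by
  simp [exchange, hs.extend_apply]

lemma exchange_inl_of_notMem (b : ι → Bool) {j : J} (hj : j ∉ Set.range s) :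
    exchange s b (Sum.inl j) = Sum.inl j := by
  rw [exchange, Sum.elim_inl, Function.extend_apply' _ _ _ fun ⟨i, hi⟩ => hj ⟨i, hi⟩]

lemma exchange_inr (b : ι → Bool) (i : ι) :
    exchange s b (Sum.inr i) = if b i then Sum.inl (s i) else Sum.inr i := rfl

lemma exchange_involutive (hs : s.Injective) (b : ι → Bool) :
    Function.Involutive (exchange s b) := by
  rintro (j | i)
  · by_cases hj : j ∈ Set.range s
    · obtain ⟨i, rfl⟩ := hj
      rw [exchange_inl_apply hs]
      cases h : b i <;> simp [h, exchange_inl_apply hs, exchange_inr]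
    · simp [exchange_inl_of_notMem b hj]
  · rw [exchange_inr]
    cases h : b i <;> simp [h, exchange_inl_apply hs, exchange_inr]

/-- Two exchanges that may differ only at `i` compose to the exchange at `i` or to nothing. -/
lemma exchange_comp (hs : s.Injective) {b b' : ι → Bool} {i : ι}
    (h : ∀ k, k ≠ i → b k = b' k) :
    exchange s b ∘ exchange s b' =
      if b i = b' i then id else Equiv.swap (Sum.inl (s i)) (Sum.inr i) := by
  funext x
  have key : ∀ k, k ≠ i → (exchange s b (exchange s b' (Sum.inl (s k))) = Sum.inl (s k) ∧
      exchange s b (exchange s b' (Sum.inr k)) = Sum.inr k) := fun k hk => by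
    rw [exchange_inl_apply hs, exchange_inr, ← h k hk]
    cases hb : b k <;> simp [hb, exchange_inl_apply hs, exchange_inr]
  have at_i : exchange s b (exchange s b' (Sum.inl (s i))) =
        (if b i = b' i then Sum.inl (s i) else Sum.inr i) ∧
      exchange s b (exchange s b' (Sum.inr i)) =
        (if b i = b' i then Sum.inr i else Sum.inl (s i)) := by
    rw [exchange_inl_apply hs, exchange_inr]
    cases hb : b i <;> cases hb' : b' i <;> simp [hb, exchange_inl_apply hs, exchange_inr]
  simp only [Function.comp_apply]
  rcases x with j | k
  · by_cases hj : j ∈ Set.range s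
    · obtain ⟨k, rfl⟩ := hj
      by_cases hk : k = i
      · subst hk
        rw [at_i.1]
        split_ifs <;> simp
      · rw [(key k hk).1]
        split_ifs
        · rfl
        · rw [Equiv.swap_apply_of_ne_of_ne (by simpa using fun h => hk (hs h)) (by simp)]
    · rw [exchange_inl_of_notMem _ hj, exchange_inl_of_notMem _ hj]
      split_ifs
      · rfl
      · rw [Equiv.swap_apply_of_ne_of_ne (by rintro ⟨⟩; exact hj ⟨i, rfl⟩) (by simp)]
  · by_cases hk : k = i
    · subst hk
      rw [at_i.2]
      split_ifs <;> simp
    · rw [(key k hk).2]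
      split_ifs
      · rfl
      · rw [Equiv.swap_apply_of_ne_of_ne (by simp) (by simpa using hk)]

end Exchange

/-! ### Operators on control qubits, test qubits and cells -/

section Quad

variable {C D ι Q : Type*} [Fintype ι] [DecidableEq ι] [Fintype Q] [DecidableEq Q]
  [Fintype D] [DecidableEq D]

/-- The registers of a parallelized circuit, with all the registers that hold a copy of the space
with basis `D` collected into one family of cells `Q`: control qubits, outputs of the first tests,
outputs of the second tests, cells. -/
abbrev Cells (ι Q D : Type*) : Type _ := (ι → Bool) × (ι → Bool) × (ι → Bool) × (Q → D)

/-- Operators on families of qubits indexed by `ι`. -/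
abbrev QubitOp (ι : Type*) : Type _ := Matrix (ι → Bool) (ι → Bool) ℂ

/-- The product operator with given actions on the control qubits, the outputs of the first tests,
the outputs of the second tests, and the cells. -/
def quad (a b e : QubitOp ι) (w : Matrix (Q → D) (Q → D) ℂ) :
    Matrix (Cells ι Q D) (Cells ι Q D) ℂ :=
  a ⊗ₖ (b ⊗ₖ (e ⊗ₖ w))

lemma quad_apply (a b e : QubitOp ι) (w : Matrix (Q → D) (Q → D) ℂ) (x y : Cells ι Q D) :
    quad a b e w x y = a x.1 y.1 * (b x.2.1 y.2.1 * (e x.2.2.1 y.2.2.1 * w x.2.2.2 y.2.2.2)) :=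
  rfl

lemma quad_mul (a b e a' b' e' : QubitOp ι) (w w' : Matrix (Q → D) (Q → D) ℂ) :
    quad a b e w * quad a' b' e' w' = quad (a * a') (b * b') (e * e') (w * w') := by
  simp only [quad, Matrix.mul_kronecker_mul]

lemma quad_one : quad 1 1 1 1 = (1 : Matrix (Cells ι Q D) (Cells ι Q D) ℂ) := by
  simp only [quad, Matrix.one_kronecker_one]

lemma quad_conjTranspose (a b e : QubitOp ι) (w : Matrix (Q → D) (Q → D) ℂ) :
    (quad a b e w)ᴴ = quad aᴴ bᴴ eᴴ wᴴ := by
  simp only [quad, Matrix.conjTranspose_kronecker]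

lemma quad_neg_control (a b e : QubitOp ι) (w : Matrix (Q → D) (Q → D) ℂ) :
    quad (-a) b e w = -quad a b e w := by
  ext x y; simp [quad_apply]

lemma quad_neg_first (a b e : QubitOp ι) (w : Matrix (Q → D) (Q → D) ℂ) :
    quad a (-b) e w = -quad a b e w := by
  ext x y; simp [quad_apply]

lemma quad_basisMap (f g h : (ι → Bool) → (ι → Bool)) (k : (Q → D) → (Q → D)) :
    quad (basisMap f) (basisMap g) (basisMap h) (basisMap k) =
      basisMap (Prod.map f (Prod.map g (Prod.map h k))) := by
  simp only [quad, basisMap_kronecker]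

/-- The operator `O` acting on the cell `q`. -/
def onCell (ι : Type*) [Fintype ι] [DecidableEq ι] (q : Q) (O : Matrix D D ℂ) :
    Matrix (Cells ι Q D) (Cells ι Q D) ℂ :=
  quad 1 1 1 (atSite q O)

/-- The operator exchanging the cells `q` and `r`. -/
def swapCells (ι D : Type*) [DecidableEq ι] [Fintype ι] [DecidableEq D] [Fintype D] (q r : Q) :
    Matrix (Cells ι Q D) (Cells ι Q D) ℂ :=
  quad 1 1 1 (basisMap fun z => z ∘ Equiv.swap q r)

/-- The operator exchanging the cells `q` and `r`, controlled by the control qubit `i`. -/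
def controlledSwap (D : Type*) [DecidableEq D] [Fintype D] (i : ι) (q r : Q) :
    Matrix (Cells ι Q D) (Cells ι Q D) ℂ :=
  (2⁻¹ : ℂ) • (swapCells ι D q r - quad (signAt i) 1 1 1 * swapCells ι D q r
    + 1 + quad (signAt i) 1 1 1)

lemma controlledSwap_eq_basisMap (i : ι) (q r : Q) :
    controlledSwap D i q r = basisMap fun x : Cells ι Q D =>
      (x.1, x.2.1, x.2.2.1, x.2.2.2 ∘ if x.1 i then ⇑(Equiv.swap q r) else id) := by
  ext ⟨c, t, u, z⟩ ⟨c', t', u', z'⟩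
  simp only [controlledSwap, swapCells, quad_mul, ← quad_one (ι := ι) (Q := Q) (D := D), one_mul,
    mul_one, Matrix.smul_apply, Matrix.add_apply, Matrix.sub_apply, quad_apply, signAt_apply,
    Matrix.one_apply, basisMap, Prod.mk.injEq, smul_eq_mul]
  by_cases h1 : c = c'
  · subst h1
    by_cases h2 : t = t'
    · by_cases h3 : u = u'
      · rcases Bool.eq_false_or_eq_true (c i) with hc | hc <;>
          simp [h2, h3, hc] <;> split_ifs <;> norm_num
      · simp [h3]
    · simp [h2]
  · simp [h1]

lemma swap_comp_involutive (q r : Q) :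
    Function.Involutive fun z : Q → D => z ∘ Equiv.swap q r := fun z => by
  funext k; simp

lemma swapCells_conj_onCell (q r : Q) (O : Matrix D D ℂ) :
    swapCells ι D q r * onCell ι q O * swapCells ι D q r = onCell ι r O := by
  simp only [swapCells, onCell, quad_mul, one_mul]
  rw [basisMap_conj (swap_comp_involutive q r)]
  congr 1
  ext z z'
  rw [Matrix.submatrix_apply, atSite_comp (fun k => Equiv.swap_apply_self q r k),
    Equiv.swap_apply_left]

lemma swapCells_mul_self (q r : Q) : swapCells ι D q r * swapCells ι D q r = 1 := by
  rw [swapCells, quad_mul, basisMap_mul_basisMap]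
  have : ((fun z : Q → D => z ∘ Equiv.swap q r) ∘ fun z => z ∘ Equiv.swap q r) = id :=
    funext fun z => swap_comp_involutive q r z
  rw [this, basisMap_id]
  simp only [mul_one, quad_one]

lemma swapCells_conjTranspose (q r : Q) : (swapCells ι D q r)ᴴ = swapCells ι D q r := by
  rw [swapCells, quad_conjTranspose, basisMap_conjTranspose (swap_comp_involutive q r)]
  simp only [Matrix.conjTranspose_one]

lemma onCell_isReflection {O : Matrix D D ℂ} (hO : IsReflection O) (q : Q) :
    IsReflection (onCell ι q O) := by
  constructor
  · rw [onCell, quad_conjTranspose, atSite_conjTranspose, hO.conjTranspose_eq]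
    simp only [Matrix.conjTranspose_one]
  · rw [onCell, quad_mul, atSite_mul, hO.mul_self, atSite_one]
    simp only [mul_one, quad_one]

end Quad

/-! ### The layers of controlled swaps -/

section Layer

variable {D ι J : Type*} [Fintype ι] [DecidableEq ι] [Fintype J] [DecidableEq J]
  [Fintype D] [DecidableEq D] {s : ι → J}

/-- For each `i`, exchange the cells `s i` and `i` if the qubits in state `(c, t, u)` tell so
through `κ c t u i`. -/
def swapLayer (D : Type*) [DecidableEq D] (s : ι → J)
    (κ : (ι → Bool) → (ι → Bool) → (ι → Bool) → ι → Bool) :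
    Matrix (Cells ι (J ⊕ ι) D) (Cells ι (J ⊕ ι) D) ℂ :=
  basisMap fun x => (x.1, x.2.1, x.2.2.1, x.2.2.2 ∘ exchange s (κ x.1 x.2.1 x.2.2.1))

variable {κ : (ι → Bool) → (ι → Bool) → (ι → Bool) → ι → Bool}

lemma swapLayer_involutive (hs : s.Injective) :
    Function.Involutive fun x : Cells ι (J ⊕ ι) D =>
      (x.1, x.2.1, x.2.2.1, x.2.2.2 ∘ exchange s (κ x.1 x.2.1 x.2.2.1)) := fun x => by
  simp only [Function.comp_assoc, (exchange_involutive hs _).comp_self, Function.comp_id]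

lemma swapLayer_conjTranspose (hs : s.Injective) :
    (swapLayer D s κ)ᴴ = swapLayer D s κ :=
  basisMap_conjTranspose (swapLayer_involutive hs)

lemma swapLayer_mul_self (hs : s.Injective) : swapLayer D s κ * swapLayer D s κ = 1 := by
  rw [swapLayer, basisMap_mul_basisMap, ← basisMap_id]
  congr 1
  exact funext fun x => swapLayer_involutive hs x

/-- Conjugation by a layer of controlled swaps fixes the operators on the qubits that do not
connect states for which different swaps are performed. -/
lemma swapLayer_conj_quad (hs : s.Injective) (a b e : QubitOp ι)
    (h : ∀ c t u c' t' u', κ c t u ≠ κ c' t' u' → a c c' * (b t t' * e u u') = 0) :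
    swapLayer D s κ * quad a b e 1 * swapLayer D s κ = quad a b e 1 := by
  rw [swapLayer, basisMap_conj (swapLayer_involutive hs)]
  ext ⟨c, t, u, z⟩ ⟨c', t', u', z'⟩
  simp only [Matrix.submatrix_apply, quad_apply]
  by_cases hκ : κ c t u = κ c' t' u'
  · have hinj : z ∘ exchange s (κ c' t' u') = z' ∘ exchange s (κ c' t' u') ↔ z = z' :=
      (exchange_involutive hs _).surjective.injective_comp_right.eq_iff
    rw [hκ, Matrix.one_apply, Matrix.one_apply, if_congr hinj rfl rfl]
  · have := h _ _ _ _ _ _ hκ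
    simp only [← mul_assoc] at this ⊢
    rw [this, zero_mul, zero_mul]

lemma swapLayer_conj_onCell_apply (hs : s.Injective) (q : J ⊕ ι) (O : Matrix D D ℂ)
    (x y : Cells ι (J ⊕ ι) D) :
    (swapLayer D s κ * onCell ι q O * swapLayer D s κ) x y =
      onCell ι (exchange s (κ x.1 x.2.1 x.2.2.1) q) O x y := by
  obtain ⟨c, t, u, z⟩ := x
  obtain ⟨c', t', u', z'⟩ := y
  rw [swapLayer, basisMap_conj (swapLayer_involutive hs)]
  simp only [Matrix.submatrix_apply, quad_apply, onCell]
  by_cases h1 : c = c'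
  · by_cases h2 : t = t'
    · by_cases h3 : u = u'
      · subst h1 h2 h3
        rw [atSite_comp (exchange_involutive hs _)]
      · simp [h3]
    · simp [h2]
  · simp [h1]

lemma swapLayer_conj_onCell_of_notMem (hs : s.Injective) {j : J} (hj : j ∉ Set.range s)
    (O : Matrix D D ℂ) :
    swapLayer D s κ * onCell ι (Sum.inl j) O * swapLayer D s κ = onCell ι (Sum.inl j) O := by
  ext x y
  rw [swapLayer_conj_onCell_apply hs, exchange_inl_of_notMem _ hj]

/-- The first layer: swap at `i` if the control qubit and the first test qubit are both set. -/
def firstLayer (D : Type*) [DecidableEq D] (s : ι → J) :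
    Matrix (Cells ι (J ⊕ ι) D) (Cells ι (J ⊕ ι) D) ℂ :=
  swapLayer D s fun c t _ i => c i && t i

/-- The second layer: swap at `i` if the control qubit and the second test qubit are both set. -/
def secondLayer (D : Type*) [DecidableEq D] (s : ι → J) :
    Matrix (Cells ι (J ⊕ ι) D) (Cells ι (J ⊕ ι) D) ℂ :=
  swapLayer D s fun c _ u i => c i && u i

lemma firstLayer_conj_onCell (hs : s.Injective) (i : ι) (O : Matrix D D ℂ) :
    firstLayer D s * onCell ι (Sum.inl (s i)) O * firstLayer D s =
      (4⁻¹ : ℂ) • ((3 : ℂ) • quad 1 1 1 (atSite (Sum.inl (s i)) O)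
        + quad (signAt i) 1 1 (atSite (Sum.inl (s i)) O)
        + quad 1 (signAt i) 1 (atSite (Sum.inl (s i)) O)
        - quad (signAt i) (signAt i) 1 (atSite (Sum.inl (s i)) O)
        + quad 1 1 1 (atSite (Sum.inr i) O)
        - quad (signAt i) 1 1 (atSite (Sum.inr i) O)
        - quad 1 (signAt i) 1 (atSite (Sum.inr i) O)
        + quad (signAt i) (signAt i) 1 (atSite (Sum.inr i) O)) := by
  ext ⟨c, t, u, z⟩ ⟨c', t', u', z'⟩
  rw [firstLayer, swapLayer_conj_onCell_apply hs, exchange_inl_apply hs]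
  simp only [onCell, Matrix.smul_apply, Matrix.add_apply, Matrix.sub_apply, quad_apply,
    signAt_apply, Matrix.one_apply, smul_eq_mul]
  by_cases h1 : c = c'
  · by_cases h2 : t = t'
    · by_cases h3 : u = u'
      · subst h1 h2 h3
        rcases Bool.eq_false_or_eq_true (c i) with hc | hc <;>
          rcases Bool.eq_false_or_eq_true (t i) with ht | ht <;> simp [hc, ht] <;> ring
      · simp [h3]
    · simp [h2]
  · simp [h1]

/-- The part of the state where the first test at `i` is not performed does not change at the
auxiliary cell `i`. -/
lemma firstLayer_conj_auxiliary (hs : s.Injective) (i : ι) (O : Matrix D D ℂ) :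
    firstLayer D s * (onCell ι (Sum.inr i) O + quad (signAt i) 1 1 1 * onCell ι (Sum.inr i) O) *
        firstLayer D s =
      onCell ι (Sum.inr i) O + quad (signAt i) 1 1 1 * onCell ι (Sum.inr i) O := by
  rw [firstLayer, swapLayer,
    basisMap_conj (swapLayer_involutive (κ := fun c t _ i => c i && t i) hs)]
  ext ⟨c, t, u, z⟩ ⟨c', t', u', z'⟩
  simp only [onCell, quad_mul, one_mul, mul_one, Matrix.submatrix_apply, Matrix.add_apply,
    quad_apply, signAt_apply, Matrix.one_apply]
  by_cases h1 : c = c'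
  · by_cases h2 : t = t'
    · by_cases h3 : u = u'
      · subst h1 h2 h3
        rw [atSite_comp (exchange_involutive hs _), exchange_inr]
        rcases Bool.eq_false_or_eq_true (c i) with hc | hc <;> simp [hc]
      · simp [h3]
    · simp [h2]
  · simp [h1]

lemma firstLayer_conj_notAt (hs : s.Injective) (i : ι) :
    firstLayer D s * quad 1 (notAt i) 1 1 * firstLayer D s =
      quad 1 (notAt i) 1 1 * controlledSwap D i (Sum.inl (s i)) (Sum.inr i) := by
  rw [notAt_eq_basisMap, ← basisMap_id, ← basisMap_id, quad_basisMap, controlledSwap_eq_basisMap,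
    firstLayer, swapLayer, basisMap_mul_basisMap, basisMap_mul_basisMap, basisMap_mul_basisMap]
  congr 1
  funext ⟨c, t, u, z⟩
  simp only [Function.comp_apply, Prod.map_apply, id, Function.comp_assoc]
  rw [exchange_comp hs (i := i)]
  · rcases Bool.eq_false_or_eq_true (c i) with hc | hc <;>
      rcases Bool.eq_false_or_eq_true (t i) with ht | ht <;> simp [hc, ht]
  · intro k hk
    simp [hk]

lemma secondLayer_conj_notAt (hs : s.Injective) (i : ι) :
    secondLayer D s * quad 1 1 (notAt i) 1 * secondLayer D s =
      quad 1 1 (notAt i) 1 * controlledSwap D i (Sum.inl (s i)) (Sum.inr i) := by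
  rw [notAt_eq_basisMap, ← basisMap_id, ← basisMap_id, quad_basisMap, controlledSwap_eq_basisMap,
    secondLayer, swapLayer, basisMap_mul_basisMap, basisMap_mul_basisMap, basisMap_mul_basisMap]
  congr 1
  funext ⟨c, t, u, z⟩
  simp only [Function.comp_apply, Prod.map_apply, id, Function.comp_assoc]
  rw [exchange_comp hs (i := i)]
  · rcases Bool.eq_false_or_eq_true (c i) with hc | hc <;>
      rcases Bool.eq_false_or_eq_true (u i) with ht | ht <;> simp [hc, ht]
  · intro k hk
    simp [hk]

end Layer

/-! ### Expectations -/

section Expectation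

variable {X Y J : Type*} [Fintype X] [DecidableEq X] [Fintype Y] [Fintype J]

/-- The expectation of the observable `A` in the (purified) state `M` of the system `X` and the
environment `J`. -/
def expect (M : Matrix X J ℂ) (A : Matrix X X ℂ) : ℂ := (Mᴴ * A * M).trace

lemma expect_add (M : Matrix X J ℂ) (A A' : Matrix X X ℂ) :
    expect M (A + A') = expect M A + expect M A' := by
  simp only [expect, Matrix.mul_add, Matrix.add_mul, Matrix.trace_add]

lemma expect_sub (M : Matrix X J ℂ) (A A' : Matrix X X ℂ) :
    expect M (A - A') = expect M A - expect M A' := by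
  simp only [expect, Matrix.mul_sub, Matrix.sub_mul, Matrix.trace_sub]

lemma expect_neg (M : Matrix X J ℂ) (A : Matrix X X ℂ) : expect M (-A) = -expect M A := by
  simp only [expect, Matrix.mul_neg, Matrix.neg_mul, Matrix.trace_neg]

lemma expect_smul (M : Matrix X J ℂ) (k : ℂ) (A : Matrix X X ℂ) :
    expect M (k • A) = k * expect M A := by
  simp only [expect, Matrix.mul_smul, Matrix.smul_mul, Matrix.trace_smul, smul_eq_mul]

lemma expect_one (M : Matrix X J ℂ) : expect M 1 = (Mᴴ * M).trace := by
  rw [expect, Matrix.mul_one]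

/-- The passage to the Heisenberg picture. -/
lemma expect_mul (G : Matrix X Y ℂ) (M : Matrix Y J ℂ) (A : Matrix X X ℂ) :
    expect (G * M) A = expect M (Gᴴ * A * G) := by
  simp only [expect, Matrix.conjTranspose_mul, Matrix.mul_assoc]

lemma expect_mul_of_fixed {M : Matrix X J ℂ} {g : Matrix X X ℂ} (hg : g * M = M)
    (A : Matrix X X ℂ) : expect M (A * g) = expect M A := by
  rw [expect, expect, ← Matrix.mul_assoc, Matrix.mul_assoc _ g, hg]

/-- An observable that changes sign under a symmetry of the state has expectation zero. -/
lemma expect_eq_zero {M : Matrix X J ℂ} {g A : Matrix X X ℂ} (hg : g * M = M)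
    (h : gᴴ * A * g = -A) : expect M A = 0 := by
  have h1 : expect M A = -expect M A := by
    conv_lhs => rw [← hg, expect_mul, h, expect_neg]
  linear_combination h1 / 2

end Expectation

/-! ### The swap test -/

section SwapTest

variable {D ι Q J : Type*} [Fintype ι] [DecidableEq ι] [Fintype Q] [DecidableEq Q]
  [Fintype D] [DecidableEq D] [Fintype J]

/-- If a swap test, controlled by a balanced control qubit, is likely to succeed, then on the branch
where it is performed the states of the two cells nearly agree. -/
lemma swap_test_sq_le {M : Matrix (Cells ι Q D) J ℂ} (hM : (Mᴴ * M).trace = 1) {i : ι} {q r : Q}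
    (hZ : expect M (quad (signAt i) 1 1 1) = 0) {e : ℝ}
    (he : 1 - 2 * e ≤ (expect M (controlledSwap D i q r)).re) {O : Matrix D D ℂ}
    (hO : IsReflection O) :
    ((expect M (onCell ι q O - quad (signAt i) 1 1 1 * onCell ι q O)).re / 2 -
      (expect M (onCell ι r O - quad (signAt i) 1 1 1 * onCell ι r O)).re / 2) ^ 2 ≤ 8 * e := by
  set Z : Matrix (Cells ι Q D) (Cells ι Q D) ℂ := quad (signAt i) 1 1 1 with hZdef
  set W := swapCells ι D q r with hW
  have hZZ : Z * Z = 1 := by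
    rw [hZdef, quad_mul, signAt_mul_self]; simp only [mul_one, quad_one]
  have hZH : Zᴴ = Z := by
    rw [hZdef, quad_conjTranspose, signAt_conjTranspose]; simp only [Matrix.conjTranspose_one]
  have comm : ∀ w : Matrix (Q → D) (Q → D) ℂ, quad 1 1 1 w * Z = Z * quad 1 1 1 w := fun w => by
    simp only [hZdef, quad_mul, mul_one, one_mul]
  -- the projection to the branch where the test is performed
  set C : Matrix (Cells ι Q D) (Cells ι Q D) ℂ := (2⁻¹ : ℂ) • (1 - Z) with hC
  have hCH : Cᴴ = C := by
    rw [hC, Matrix.conjTranspose_smul, Matrix.conjTranspose_sub, hZH, Matrix.conjTranspose_one]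
    simp
  have hCC : C * C = C := by
    rw [hC, Matrix.smul_mul, Matrix.mul_smul, Matrix.sub_mul, Matrix.mul_sub, Matrix.mul_sub, hZZ,
      Matrix.one_mul, Matrix.mul_one, Matrix.one_mul, smul_smul]
    module
  have hCw : ∀ w : Matrix (Q → D) (Q → D) ℂ,
      C * quad 1 1 1 w * C = (2⁻¹ : ℂ) • (quad 1 1 1 w - Z * quad 1 1 1 w) := fun w => by
    have h1 : quad 1 1 1 w * C = C * quad 1 1 1 w := by
      rw [hC, Matrix.mul_smul, Matrix.smul_mul, Matrix.mul_sub, Matrix.sub_mul, comm,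
        Matrix.mul_one, Matrix.one_mul]
    rw [Matrix.mul_assoc, h1, ← Matrix.mul_assoc, hCC, hC, Matrix.smul_mul, Matrix.sub_mul,
      Matrix.one_mul]
  have hWW : W * W = 1 := swapCells_mul_self q r
  have hWH : Wᴴ = W := swapCells_conjTranspose q r
  have key := (onCell_isReflection (ι := ι) hO q).sub_sq_le (C * M) (W * (C * M))
  have h1 : ((C * M)ᴴ * onCell ι q O * (C * M)).trace =
      2⁻¹ * expect M (onCell ι q O - Z * onCell ι q O) := by
    change expect (C * M) _ = _
    rw [expect_mul, hCH, onCell, hCw, expect_smul]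
  have h2 : ((W * (C * M))ᴴ * onCell ι q O * (W * (C * M))).trace =
      2⁻¹ * expect M (onCell ι r O - Z * onCell ι r O) := by
    change expect (W * (C * M)) _ = _
    rw [expect_mul, hWH, hW, swapCells_conj_onCell, expect_mul, hCH, onCell, hCw, expect_smul]
  have h3 : ((C * M)ᴴ * (C * M)).trace = 2⁻¹ := by
    rw [← expect_one, expect_mul, hCH, Matrix.mul_one, hCC, hC, expect_smul, expect_sub, hZ,
      expect_one, hM]
    ring
  have h4 : ((W * (C * M))ᴴ * (W * (C * M))).trace = 2⁻¹ := by
    rw [← h3, ← expect_one, expect_mul, hWH, Matrix.mul_one, hWW, expect_one]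
  have h5 : ((C * M)ᴴ * (W * (C * M))).trace = expect M (controlledSwap D i q r) - 2⁻¹ := by
    rw [← Matrix.mul_assoc]
    change expect (C * M) _ = _
    rw [expect_mul, hCH, hW, swapCells, hCw, controlledSwap, expect_smul, expect_smul, expect_add,
      expect_add, hZ, expect_one, hM, swapCells]
    ring
  rw [re_trace_sub_sq, re_trace_add_sq, h1, h2, h3, h4, h5] at key
  have h6 := trace_conjTranspose_mul_self_nonneg (C * M - W * (C * M))
  rw [re_trace_sub_sq, h3, h4, h5] at h6
  have half : ∀ z : ℂ, (2⁻¹ * z).re = z.re / 2 := fun z => by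
    rw [show (2⁻¹ : ℂ) = ((2⁻¹ : ℝ) : ℂ) by norm_num, Complex.re_ofReal_mul]; ring
  have half' : (2⁻¹ : ℂ).re = 1 / 2 := by norm_num
  simp only [half, half', Complex.sub_re] at key h6 ⊢
  nlinarith [sq_nonneg (1 - (expect M (controlledSwap D i q r)).re)]

end SwapTest

/-! ### One interface of the parallelized circuit -/

section Interface

variable {D ι J E : Type*} [Fintype ι] [DecidableEq ι] [Fintype J] [DecidableEq J]
  [Fintype D] [DecidableEq D] [Fintype E]

/-- The first swap tests, between the cells `s i` and the auxiliary cells `i`. -/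
def firstTests (D : Type*) [Fintype D] [DecidableEq D] (s : ι → J) :
    Matrix (Cells ι (J ⊕ ι) D) (Cells ι (J ⊕ ι) D) ℂ :=
  quad 1 (hadamards ι) 1 1 * firstLayer D s * quad 1 (hadamards ι) 1 1

/-- The second swap tests, between the cells `s i` and the auxiliary cells `i`. -/
def secondTests (D : Type*) [Fintype D] [DecidableEq D] (s : ι → J) :
    Matrix (Cells ι (J ⊕ ι) D) (Cells ι (J ⊕ ι) D) ℂ :=
  quad 1 1 (hadamards ι) 1 * secondLayer D s * quad 1 1 (hadamards ι) 1

/-- Not gates on the control qubits, and the operator `U j` on each cell `j`; the auxiliary cells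
are left alone. -/
def flipAndPieces (ι : Type*) [Fintype ι] [DecidableEq ι] (U : J → Matrix D D ℂ) :
    Matrix (Cells ι (J ⊕ ι) D) (Cells ι (J ⊕ ι) D) ℂ :=
  quad (nots ι) 1 1 (tensor (Sum.elim U fun _ => 1))

variable {s : ι → J} {U : J → Matrix D D ℂ}

lemma firstTests_conj (hs : s.Injective) (A : Matrix (Cells ι (J ⊕ ι) D) (Cells ι (J ⊕ ι) D) ℂ) :
    (firstTests D s)ᴴ * A * firstTests D s =
      quad 1 (hadamards ι) 1 1 * (firstLayer D s *
        (quad 1 (hadamards ι) 1 1 * A * quad 1 (hadamards ι) 1 1) * firstLayer D s) *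
          quad 1 (hadamards ι) 1 1 := by
  have h : (firstLayer D s)ᴴ = firstLayer D s := swapLayer_conjTranspose hs
  simp only [firstTests, Matrix.conjTranspose_mul, quad_conjTranspose, Matrix.conjTranspose_one,
    hadamards_conjTranspose, h, Matrix.mul_assoc]

lemma secondTests_conj (hs : s.Injective)
    (A : Matrix (Cells ι (J ⊕ ι) D) (Cells ι (J ⊕ ι) D) ℂ) :
    (secondTests D s)ᴴ * A * secondTests D s =
      quad 1 1 (hadamards ι) 1 * (secondLayer D s *
        (quad 1 1 (hadamards ι) 1 * A * quad 1 1 (hadamards ι) 1) * secondLayer D s) *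
          quad 1 1 (hadamards ι) 1 := by
  have h : (secondLayer D s)ᴴ = secondLayer D s := swapLayer_conjTranspose hs
  simp only [secondTests, Matrix.conjTranspose_mul, quad_conjTranspose, Matrix.conjTranspose_one,
    hadamards_conjTranspose, h, Matrix.mul_assoc]

/-- The outcome of the first test at `i` is the value of the controlled exchange of the two cells
under test, once the output qubit is known to be in the state `|0⟩`, which the last factor fixes. -/
lemma firstTests_conj_signAt_first (hs : s.Injective) (i : ι) :
    (firstTests D s)ᴴ * quad 1 (signAt i) 1 1 * firstTests D s =
      controlledSwap D i (Sum.inl (s i)) (Sum.inr i) * quad 1 (signAt i) 1 1 := by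
  rw [firstTests_conj hs]
  simp only [quad_mul, Matrix.mul_one]
  rw [hadamards_conj_signAt, firstLayer_conj_notAt hs, controlledSwap, swapCells]
  simp only [Matrix.mul_smul, Matrix.smul_mul, Matrix.mul_add, Matrix.mul_sub, Matrix.add_mul,
    Matrix.sub_mul, quad_mul, Matrix.one_mul, Matrix.mul_one, hadamards_conj_notAt]

lemma secondTests_conj_signAt_second (hs : s.Injective) (i : ι) :
    (secondTests D s)ᴴ * quad 1 1 (signAt i) 1 * secondTests D s =
      controlledSwap D i (Sum.inl (s i)) (Sum.inr i) * quad 1 1 (signAt i) 1 := by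
  rw [secondTests_conj hs]
  simp only [quad_mul, Matrix.mul_one]
  rw [hadamards_conj_signAt, secondLayer_conj_notAt hs, controlledSwap, swapCells]
  simp only [Matrix.mul_smul, Matrix.smul_mul, Matrix.mul_add, Matrix.mul_sub, Matrix.add_mul,
    Matrix.sub_mul, quad_mul, Matrix.one_mul, Matrix.mul_one, hadamards_conj_notAt]

lemma secondTests_conj_signAt_first (hs : s.Injective) (i : ι) :
    (secondTests D s)ᴴ * quad 1 (signAt i) 1 1 * secondTests D s = quad 1 (signAt i) 1 1 := by
  rw [secondTests_conj hs]
  simp only [quad_mul, Matrix.one_mul, Matrix.mul_one, hadamards_mul_self]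
  rw [secondLayer, swapLayer_conj_quad hs]
  · simp only [quad_mul, Matrix.one_mul, Matrix.mul_one, hadamards_mul_self]
  · intro c t u c' t' u' h
    by_cases hc : c = c'
    · by_cases hu : u = u'
      · subst hc hu; exact absurd rfl h
      · simp [Matrix.one_apply, hu]
    · simp [Matrix.one_apply, hc]

lemma firstTests_conj_signAt_control (hs : s.Injective) (i : ι) :
    (firstTests D s)ᴴ * quad (signAt i) 1 1 1 * firstTests D s = quad (signAt i) 1 1 1 := by
  rw [firstTests_conj hs]
  simp only [quad_mul, Matrix.one_mul, Matrix.mul_one, hadamards_mul_self]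
  rw [firstLayer, swapLayer_conj_quad hs]
  · simp only [quad_mul, Matrix.one_mul, Matrix.mul_one, hadamards_mul_self]
  · intro c t u c' t' u' h
    by_cases hc : c = c'
    · by_cases ht : t = t'
      · subst hc ht; exact absurd rfl h
      · simp [Matrix.one_apply, ht]
    · simp [signAt_apply, hc]

lemma firstTests_conj_signAt_second (hs : s.Injective) (i : ι) :
    (firstTests D s)ᴴ * quad 1 1 (signAt i) 1 * firstTests D s = quad 1 1 (signAt i) 1 := by
  rw [firstTests_conj hs]
  simp only [quad_mul, Matrix.one_mul, Matrix.mul_one, hadamards_mul_self]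
  rw [firstLayer, swapLayer_conj_quad hs]
  · simp only [quad_mul, Matrix.one_mul, Matrix.mul_one, hadamards_mul_self]
  · intro c t u c' t' u' h
    by_cases hc : c = c'
    · by_cases ht : t = t'
      · subst hc ht; exact absurd rfl h
      · simp [Matrix.one_apply, ht]
    · simp [Matrix.one_apply, hc]

lemma firstTests_isometry (hs : s.Injective) : (firstTests D s)ᴴ * firstTests D s = 1 := by
  have h := firstTests_conj hs (1 : Matrix (Cells ι (J ⊕ ι) D) (Cells ι (J ⊕ ι) D) ℂ)
  have h2 : firstLayer D s * firstLayer D s = 1 := swapLayer_mul_self hs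
  simpa only [quad_mul, Matrix.one_mul, Matrix.mul_one, hadamards_mul_self, quad_one, h2] using h

lemma secondTests_isometry (hs : s.Injective) : (secondTests D s)ᴴ * secondTests D s = 1 := by
  have h := secondTests_conj hs (1 : Matrix (Cells ι (J ⊕ ι) D) (Cells ι (J ⊕ ι) D) ℂ)
  have h2 : secondLayer D s * secondLayer D s = 1 := swapLayer_mul_self hs
  simpa only [quad_mul, Matrix.one_mul, Matrix.mul_one, hadamards_mul_self, quad_one, h2] using h

lemma firstTests_conj_onCell_of_notMem (hs : s.Injective) {j : J} (hj : j ∉ Set.range s)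
    (O : Matrix D D ℂ) :
    (firstTests D s)ᴴ * onCell ι (Sum.inl j) O * firstTests D s = onCell ι (Sum.inl j) O := by
  rw [firstTests_conj hs]
  have h : ∀ w : Matrix (J ⊕ ι → D) (J ⊕ ι → D) ℂ,
      quad 1 (hadamards ι) 1 1 * quad 1 1 1 w * quad 1 (hadamards ι) 1 1 = quad 1 1 1 w := by
    intro w
    simp only [quad_mul, Matrix.one_mul, Matrix.mul_one, hadamards_mul_self]
  rw [onCell, h, firstLayer, ← onCell, swapLayer_conj_onCell_of_notMem hs hj, onCell, h]

lemma secondTests_conj_onCell_of_notMem (hs : s.Injective) {j : J} (hj : j ∉ Set.range s)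
    (O : Matrix D D ℂ) :
    (secondTests D s)ᴴ * onCell ι (Sum.inl j) O * secondTests D s = onCell ι (Sum.inl j) O := by
  rw [secondTests_conj hs]
  have h : ∀ w : Matrix (J ⊕ ι → D) (J ⊕ ι → D) ℂ,
      quad 1 1 (hadamards ι) 1 * quad 1 1 1 w * quad 1 1 (hadamards ι) 1 = quad 1 1 1 w := by
    intro w
    simp only [quad_mul, Matrix.one_mul, Matrix.mul_one, hadamards_mul_self]
  rw [onCell, h, secondLayer, ← onCell, swapLayer_conj_onCell_of_notMem hs hj, onCell, h]

/-- An observable on the cell `s i` after the first tests. All terms but those without a gate on a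
qubit have expectation zero in the initial state, so the first tests replace the state `σ` of the
cell by `3/4 σ + 1/4 τ`, where `τ` is the state of the auxiliary cell `i`. -/
lemma firstTests_conj_onCell (hs : s.Injective) (i : ι) (O : Matrix D D ℂ) :
    (firstTests D s)ᴴ * onCell ι (Sum.inl (s i)) O * firstTests D s =
      (4⁻¹ : ℂ) • ((3 : ℂ) • quad 1 1 1 (atSite (Sum.inl (s i)) O)
        + quad (signAt i) 1 1 (atSite (Sum.inl (s i)) O)
        + quad 1 (notAt i) 1 (atSite (Sum.inl (s i)) O)
        - quad (signAt i) (notAt i) 1 (atSite (Sum.inl (s i)) O)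
        + quad 1 1 1 (atSite (Sum.inr i) O)
        - quad (signAt i) 1 1 (atSite (Sum.inr i) O)
        - quad 1 (notAt i) 1 (atSite (Sum.inr i) O)
        + quad (signAt i) (notAt i) 1 (atSite (Sum.inr i) O)) := by
  have h : ∀ w : Matrix (J ⊕ ι → D) (J ⊕ ι → D) ℂ,
      quad 1 (hadamards ι) 1 1 * quad 1 1 1 w * quad 1 (hadamards ι) 1 1 = quad 1 1 1 w := by
    intro w
    simp only [quad_mul, Matrix.one_mul, Matrix.mul_one, hadamards_mul_self]
  have hl := firstLayer_conj_onCell hs i O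
  rw [onCell] at hl
  rw [firstTests_conj hs, onCell, h, hl]
  simp only [Matrix.mul_smul, Matrix.smul_mul, Matrix.mul_add, Matrix.mul_sub, Matrix.add_mul,
    Matrix.sub_mul, quad_mul, Matrix.one_mul, Matrix.mul_one, hadamards_conj_signAt,
    hadamards_mul_self]

lemma firstTests_conj_auxiliary (hs : s.Injective) (i : ι) (O : Matrix D D ℂ) :
    (firstTests D s)ᴴ * (onCell ι (Sum.inr i) O + quad (signAt i) 1 1 1 * onCell ι (Sum.inr i) O) *
        firstTests D s =
      onCell ι (Sum.inr i) O + quad (signAt i) 1 1 1 * onCell ι (Sum.inr i) O := by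
  have h : ∀ (a : QubitOp ι) (w : Matrix (J ⊕ ι → D) (J ⊕ ι → D) ℂ),
      quad 1 (hadamards ι) 1 1 * quad a 1 1 w * quad 1 (hadamards ι) 1 1 = quad a 1 1 w := by
    intro a w
    simp only [quad_mul, Matrix.one_mul, Matrix.mul_one, hadamards_mul_self]
  have h' : quad 1 (hadamards ι) 1 1 *
      (onCell ι (Sum.inr i) O + quad (signAt i) 1 1 1 * onCell ι (Sum.inr i) O) *
        quad 1 (hadamards ι) 1 1 =
      (onCell ι (Sum.inr i) O + quad (signAt i) 1 1 1 * onCell ι (Sum.inr i) O :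
        Matrix (Cells ι (J ⊕ ι) D) (Cells ι (J ⊕ ι) D) ℂ) := by
    simp only [onCell, Matrix.mul_add, Matrix.add_mul, ← Matrix.mul_assoc]
    rw [h, Matrix.mul_assoc (quad 1 (hadamards ι) 1 1), quad_mul]
    simp only [Matrix.one_mul, Matrix.mul_one, h]
  rw [firstTests_conj hs, h', firstLayer_conj_auxiliary hs, h']

lemma flipAndPieces_conj (hU : ∀ j, (U j)ᴴ * U j = 1) (a b e : QubitOp ι) (q : J ⊕ ι)
    (O : Matrix D D ℂ) :
    (flipAndPieces ι U)ᴴ * quad a b e (atSite q O) * flipAndPieces ι U =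
      quad (nots ι * a * nots ι) b e (atSite q
        ((Sum.elim U (fun _ => 1) q)ᴴ * O * Sum.elim U (fun _ => 1) q)) := by
  rw [flipAndPieces, quad_conjTranspose, quad_mul, quad_mul, tensor_isometry_conj_atSite,
    nots_conjTranspose]
  · simp only [Matrix.conjTranspose_one, Matrix.one_mul, Matrix.mul_one]
  · rintro (j | i)
    · exact hU j
    · simp

lemma flipAndPieces_conj_qubits (hU : ∀ j, (U j)ᴴ * U j = 1) (a b e : QubitOp ι) :
    (flipAndPieces ι U)ᴴ * quad a b e 1 * flipAndPieces ι U =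
      quad (nots ι * a * nots ι) b e 1 := by
  have h : (tensor (Sum.elim U fun _ => 1) : Matrix (J ⊕ ι → D) (J ⊕ ι → D) ℂ)ᴴ *
      tensor (Sum.elim U fun _ => 1) = 1 := by
    rw [tensor_conjTranspose, tensor_mul, ← tensor_one]
    congr 1
    funext q
    rcases q with j | i
    · exact hU j
    · simp
  rw [flipAndPieces, quad_conjTranspose, quad_mul, quad_mul, nots_conjTranspose]
  simp only [Matrix.conjTranspose_one, Matrix.one_mul, Matrix.mul_one, h]

lemma flipAndPieces_conj_onCell (hU : ∀ j, (U j)ᴴ * U j = 1) (j : J) (O : Matrix D D ℂ) :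
    (flipAndPieces ι U)ᴴ * onCell ι (Sum.inl j) O * flipAndPieces ι U =
      onCell ι (Sum.inl j) ((U j)ᴴ * O * U j) := by
  rw [onCell, flipAndPieces_conj hU, Matrix.mul_one, nots_mul_self]
  rfl

lemma flipAndPieces_isometry (hU : ∀ j, (U j)ᴴ * U j = 1) :
    (flipAndPieces ι U)ᴴ * flipAndPieces ι U = 1 := by
  have h := flipAndPieces_conj_qubits hU 1 1 (1 : QubitOp ι)
  simpa only [quad_one, Matrix.mul_one, nots_mul_self] using h

lemma trace_isometry_mul {X Y : Type*} [Fintype X] [Fintype Y] [DecidableEq Y]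
    {G : Matrix X Y ℂ} (hG : Gᴴ * G = 1)
    (M : Matrix Y E ℂ) : ((G * M)ᴴ * (G * M)).trace = (Mᴴ * M).trace := by
  rw [Matrix.conjTranspose_mul, Matrix.mul_assoc, ← Matrix.mul_assoc Gᴴ, hG, Matrix.one_mul]

lemma IsReflection.conj {V O : Matrix D D ℂ} (hO : IsReflection O) (hV : Vᴴ * V = 1) :
    IsReflection (Vᴴ * O * V) := by
  have hV' : V * Vᴴ = 1 := mul_eq_one_comm.1 hV
  constructor
  · simp only [Matrix.conjTranspose_mul, Matrix.conjTranspose_conjTranspose, hO.conjTranspose_eq,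
      Matrix.mul_assoc]
  · calc _ = Vᴴ * O * (V * Vᴴ) * O * V := by simp only [Matrix.mul_assoc]
      _ = Vᴴ * (O * O) * V := by rw [hV', Matrix.mul_one]; simp only [Matrix.mul_assoc]
      _ = 1 := by rw [hO.mul_self, Matrix.mul_one, hV]

/-- A state of all the registers in which the control qubits are in the state `(|0⟩ + |1⟩)/√2` and
the output qubits of the tests in the state `|0⟩`, expressed by the symmetries of that state. -/
structure IsReady {Q : Type*} [Fintype Q] [DecidableEq Q] (M : Matrix (Cells ι Q D) E ℂ) :
    Prop where
  trace_eq_one : (Mᴴ * M).trace = 1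
  control : ∀ i, (quad (notAt i) 1 1 1 : Matrix (Cells ι Q D) (Cells ι Q D) ℂ) * M = M
  first : ∀ i, (quad 1 (signAt i) 1 1 : Matrix (Cells ι Q D) (Cells ι Q D) ℂ) * M = M
  second : ∀ i, (quad 1 1 (signAt i) 1 : Matrix (Cells ι Q D) (Cells ι Q D) ℂ) * M = M

section Ready

variable {Q : Type*} [Fintype Q] [DecidableEq Q] {M : Matrix (Cells ι Q D) E ℂ}

lemma IsReady.expect_control_eq_zero (hM : IsReady M) (i : ι) {a : QubitOp ι}
    (ha : notAt i * a * notAt i = -a) (b e : QubitOp ι) (w : Matrix (Q → D) (Q → D) ℂ) :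
    expect M (quad a b e w) = 0 := by
  refine expect_eq_zero (hM.control i) ?_
  rw [quad_conjTranspose, quad_mul, quad_mul, notAt_conjTranspose, ha, quad_neg_control]
  simp only [Matrix.conjTranspose_one, Matrix.one_mul, Matrix.mul_one]

lemma IsReady.expect_signAt (hM : IsReady M) (i : ι) (b e : QubitOp ι)
    (w : Matrix (Q → D) (Q → D) ℂ) : expect M (quad (signAt i) b e w) = 0 :=
  hM.expect_control_eq_zero i (notAt_conj_signAt i) b e w

lemma IsReady.expect_notAt (hM : IsReady M) (i : ι) (a e : QubitOp ι)
    (w : Matrix (Q → D) (Q → D) ℂ) : expect M (quad a (notAt i) e w) = 0 := by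
  refine expect_eq_zero (hM.first i) ?_
  rw [quad_conjTranspose, quad_mul, quad_mul, signAt_conjTranspose, signAt_conj_notAt,
    quad_neg_first]
  simp only [Matrix.conjTranspose_one, Matrix.one_mul, Matrix.mul_one]

end Ready

variable {s₁ s₂ : ι → J} {M : Matrix (Cells ι (J ⊕ ι) D) E ℂ}

/-- The control qubit of an interface is independent of the cell on which the second test of the
interface acts, as that cell takes part in the first test of another interface at most. -/
lemma IsReady.expect_signAt_onCell (hM : IsReady M) (h₁ : s₁.Injective) {i : ι} {j : J}
    (hj : j ≠ s₁ i) (O : Matrix D D ℂ) :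
    expect (firstTests D s₁ * M) (quad (signAt i) 1 1 1 * onCell ι (Sum.inl j) O) = 0 := by
  have hT : firstTests D s₁ * (firstTests D s₁)ᴴ = 1 := mul_eq_one_comm.1 (firstTests_isometry h₁)
  have hsplit : (firstTests D s₁)ᴴ * (quad (signAt i) 1 1 1 * onCell ι (Sum.inl j) O) *
      firstTests D s₁ = quad (signAt i) 1 1 1 *
        ((firstTests D s₁)ᴴ * onCell ι (Sum.inl j) O * firstTests D s₁) := by
    conv_rhs => rw [← firstTests_conj_signAt_control h₁ i]
    calc _ = (firstTests D s₁)ᴴ * quad (signAt i) 1 1 1 * 1 * onCell ι (Sum.inl j) O *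
          firstTests D s₁ := by simp only [Matrix.mul_one, Matrix.mul_assoc]
      _ = (firstTests D s₁)ᴴ * quad (signAt i) 1 1 1 * (firstTests D s₁ * (firstTests D s₁)ᴴ) *
          onCell ι (Sum.inl j) O * firstTests D s₁ := by rw [hT]
      _ = _ := by simp only [Matrix.mul_assoc]
  rw [expect_mul, hsplit]
  by_cases hmem : j ∈ Set.range s₁
  · obtain ⟨k, rfl⟩ := hmem
    have hki : k ≠ i := fun h => hj (by rw [h])
    have hsgn : notAt i * (signAt i * signAt k) * notAt i = -(signAt i * signAt k) := by
      have hcomm : signAt k * notAt i = notAt i * signAt k := atSite_mul_comm hki _ _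
      rw [← Matrix.mul_assoc, Matrix.mul_assoc (_ * _), hcomm, ← Matrix.mul_assoc,
        notAt_conj_signAt, Matrix.neg_mul]
    rw [firstTests_conj_onCell h₁]
    simp only [Matrix.mul_smul, Matrix.mul_add, Matrix.mul_sub, quad_mul, Matrix.one_mul,
      Matrix.mul_one, expect_smul, expect_add, expect_sub, hM.expect_signAt i,
      hM.expect_control_eq_zero i hsgn, add_zero, sub_zero, mul_zero]
  · rw [firstTests_conj_onCell_of_notMem h₁ hmem, onCell, quad_mul]
    simp only [Matrix.mul_one, hM.expect_signAt i]

/-- If both swap tests of the interface `i` are likely to succeed, then the output of the piece on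
the cell `s₂ i` before the interface is close to the input of the piece on the cell `s₁ i` after the
interface: both are close to the auxiliary cell. -/
lemma IsReady.interface_le (hM : IsReady M) (h₁ : s₁.Injective) (h₂ : s₂.Injective)
    (hU : ∀ j, (U j)ᴴ * U j = 1) {i : ι} (hi : s₂ i ≠ s₁ i) {e : ℝ}
    (hfirst : 1 - 2 * e ≤ (expect (secondTests D s₂ * (flipAndPieces ι U * (firstTests D s₁ * M)))
      (quad 1 (signAt i) 1 1)).re)
    (hsecond : 1 - 2 * e ≤ (expect (secondTests D s₂ * (flipAndPieces ι U * (firstTests D s₁ * M)))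
      (quad 1 1 (signAt i) 1)).re) {O : Matrix D D ℂ} (hO : IsReflection O) :
    |(expect (firstTests D s₁ * M) (onCell ι (Sum.inl (s₁ i)) O)).re -
      (expect (flipAndPieces ι U * (firstTests D s₁ * M)) (onCell ι (Sum.inl (s₂ i)) O)).re| ≤
        12 * √e := by
  set M₂ := firstTests D s₁ * M with hM₂
  set M₃ := flipAndPieces ι U * M₂ with hM₃
  have htr : (M₃ᴴ * M₃).trace = 1 := by
    rw [hM₃, trace_isometry_mul (flipAndPieces_isometry hU), hM₂,
      trace_isometry_mul (firstTests_isometry h₁), hM.trace_eq_one]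
  -- the first test, in terms of the initial state
  have t1 : 1 - 2 * e ≤ (expect M (controlledSwap D i (Sum.inl (s₁ i)) (Sum.inr i))).re := by
    rw [expect_mul, secondTests_conj_signAt_first h₂, hM₃, expect_mul,
      flipAndPieces_conj_qubits hU, Matrix.mul_one, nots_mul_self, hM₂, expect_mul,
      firstTests_conj_signAt_first h₁, expect_mul_of_fixed (hM.first i)] at hfirst
    exact hfirst
  have b1 := swap_test_sq_le hM.trace_eq_one (hM.expect_signAt i 1 1 1) t1 hO
  -- the second test, in terms of the state before it
  have fixed : quad 1 1 (signAt i) 1 * M₃ = M₃ := by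
    have c1 : quad 1 1 (signAt i) 1 * firstTests D s₁ =
        firstTests D s₁ * quad 1 1 (signAt i) 1 := by
      have hT : firstTests D s₁ * (firstTests D s₁)ᴴ = 1 :=
        mul_eq_one_comm.1 (firstTests_isometry h₁)
      conv_rhs => rw [← firstTests_conj_signAt_second h₁ i]
      rw [← Matrix.mul_assoc, ← Matrix.mul_assoc, hT, Matrix.one_mul]
    have c2 : quad 1 1 (signAt i) 1 * flipAndPieces ι U =
        flipAndPieces ι U * quad 1 1 (signAt i) 1 := by
      simp only [flipAndPieces, quad_mul, Matrix.one_mul, Matrix.mul_one]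
    calc quad 1 1 (signAt i) 1 * M₃ = quad 1 1 (signAt i) 1 * flipAndPieces ι U * M₂ :=
          (Matrix.mul_assoc _ _ _).symm
      _ = flipAndPieces ι U * (quad 1 1 (signAt i) 1 * firstTests D s₁ * M) := by
          rw [c2, hM₂, Matrix.mul_assoc, Matrix.mul_assoc]
      _ = M₃ := by rw [c1, Matrix.mul_assoc, hM.second i]
  have t2 : 1 - 2 * e ≤ (expect M₃ (controlledSwap D i (Sum.inl (s₂ i)) (Sum.inr i))).re := by
    rw [expect_mul, secondTests_conj_signAt_second h₂, expect_mul_of_fixed fixed] at hsecond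
    exact hsecond
  have z3 : expect M₃ (quad (signAt i) 1 1 1) = 0 := by
    rw [hM₃, expect_mul, flipAndPieces_conj_qubits hU, nots_conj_signAt, quad_neg_control,
      expect_neg, hM₂, expect_mul, firstTests_conj_signAt_control h₁, hM.expect_signAt, neg_zero]
  have b2 := swap_test_sq_le htr z3 t2 hO
  -- the control qubit is independent of the cells under test
  have v1 : ∀ q, expect M (quad (signAt i) 1 1 1 * onCell ι q O) = 0 := fun q => by
    rw [onCell, quad_mul]
    simp only [Matrix.mul_one, hM.expect_signAt i]
  have v2 : expect M₃ (quad (signAt i) 1 1 1 * onCell ι (Sum.inl (s₂ i)) O) = 0 := by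
    have h := flipAndPieces_conj hU (signAt i) 1 1 (Sum.inl (s₂ i)) O
    have h0 := hM.expect_signAt_onCell h₁ hi ((U (s₂ i))ᴴ * O * U (s₂ i))
    rw [onCell, quad_mul, Matrix.mul_one, Matrix.mul_one, Matrix.one_mul] at h0 ⊢
    rw [hM₃, expect_mul, h, nots_conj_signAt, quad_neg_control, expect_neg]
    exact neg_eq_zero.2 h0
  have v3 : expect M₃ (onCell ι (Sum.inr i) O - quad (signAt i) 1 1 1 * onCell ι (Sum.inr i) O) =
      expect M (onCell ι (Sum.inr i) O) := by
    have h : (flipAndPieces ι U)ᴴ *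
        (onCell ι (Sum.inr i) O - quad (signAt i) 1 1 1 * onCell ι (Sum.inr i) O) *
          flipAndPieces ι U =
        onCell ι (Sum.inr i) O + quad (signAt i) 1 1 1 * onCell ι (Sum.inr i) O := by
      rw [onCell, quad_mul, Matrix.mul_one, Matrix.mul_one, Matrix.one_mul, Matrix.mul_sub,
        Matrix.sub_mul, flipAndPieces_conj hU, flipAndPieces_conj hU, nots_conj_signAt,
        Matrix.mul_one, nots_mul_self, quad_neg_control, sub_neg_eq_add]
      simp only [Sum.elim_inr, Matrix.conjTranspose_one, Matrix.one_mul, Matrix.mul_one]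
    rw [hM₃, expect_mul, h, hM₂, expect_mul, firstTests_conj_auxiliary h₁, expect_add, v1, add_zero]
  -- the effect of the first tests on the cell after the interface
  have v4 : expect M₂ (onCell ι (Sum.inl (s₁ i)) O) =
      4⁻¹ * (3 * expect M (onCell ι (Sum.inl (s₁ i)) O) + expect M (onCell ι (Sum.inr i) O)) := by
    rw [hM₂, expect_mul, firstTests_conj_onCell h₁]
    simp only [onCell, expect_smul, expect_add, expect_sub, hM.expect_signAt i, hM.expect_notAt i,
      add_zero, sub_zero]
  rw [expect_sub, expect_sub, v1, v1, sub_zero, sub_zero] at b1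
  rw [expect_sub, v2, sub_zero, v3] at b2
  have v5 := congrArg Complex.re v4
  rw [show (4⁻¹ : ℂ) = ((4⁻¹ : ℝ) : ℂ) by norm_num, Complex.re_ofReal_mul, Complex.add_re,
    show (3 : ℂ) = ((3 : ℝ) : ℂ) by norm_num, Complex.re_ofReal_mul] at v5
  rw [v5]
  have he : 0 ≤ e := by nlinarith [sq_nonneg ((expect M (onCell ι (Sum.inl (s₁ i)) O)).re / 2 -
    (expect M (onCell ι (Sum.inr i) O)).re / 2)]
  have hsq : √e ^ 2 = e := Real.sq_sqrt he
  have h8 : 8 * e ≤ (3 * √e) ^ 2 := by nlinarith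
  -- `√8 ≤ 3`, and `3 / 4 * (2 * 3) + 2 * 3 ≤ 12`
  have c1 := abs_le.1 <| abs_le_of_sq_le_sq (b1.trans h8) (by positivity)
  have c2 := abs_le.1 <| abs_le_of_sq_le_sq (b2.trans h8) (by positivity)
  rw [abs_le]
  constructor <;> linarith [c1.1, c1.2, c2.1, c2.2, Real.sqrt_nonneg e]

end Interface

/-! ### Partial traces -/

section PartialTrace

variable {X Y E : Type*} [Fintype X] [DecidableEq X] [Fintype Y] [DecidableEq Y] [Fintype E]

lemma trace_one_kronecker_mul (S : Matrix Y Y ℂ) (τ : Matrix (X × Y) (X × Y) ℂ) :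
    (((1 : Matrix X X ℂ) ⊗ₖ S) * τ).trace = (S * trLeft τ).trace := by
  calc _ = ∑ x, ∑ y, ∑ y', S y y' * τ (x, y') (x, y) := by
        simp only [Matrix.trace, Matrix.diag, Matrix.mul_apply, Fintype.sum_prod_type,
          Matrix.kroneckerMap_apply, Matrix.one_apply, ite_mul, one_mul, zero_mul]
        refine Finset.sum_congr rfl fun x _ => Finset.sum_congr rfl fun y _ => ?_
        rw [Finset.sum_comm]
        simp
    _ = _ := by
        simp only [Matrix.trace, Matrix.diag, Matrix.mul_apply, trLeft, Finset.mul_sum]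
        rw [Finset.sum_comm]
        exact Finset.sum_congr rfl fun y _ => Finset.sum_comm

lemma trace_kronecker_one_mul (S : Matrix X X ℂ) (τ : Matrix (X × Y) (X × Y) ℂ) :
    ((S ⊗ₖ (1 : Matrix Y Y ℂ)) * τ).trace = (S * trRight τ).trace := by
  simp only [Matrix.trace, Matrix.diag, Matrix.mul_apply, Fintype.sum_prod_type, trRight,
    Matrix.kroneckerMap_apply, Matrix.one_apply, Finset.mul_sum, mul_ite, ite_mul, mul_one,
    zero_mul, mul_zero]
  refine Finset.sum_congr rfl fun x _ => ?_
  rw [Finset.sum_comm]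
  simp

lemma trLeft_posSemidef {τ : Matrix (X × Y) (X × Y) ℂ} (hτ : τ.PosSemidef) :
    (trLeft τ).PosSemidef := by
  have h : trLeft τ = ∑ x, τ.submatrix (fun y => (x, y)) fun y => (x, y) := by
    ext y y'
    simp [trLeft, Matrix.sum_apply]
  rw [h]
  exact Matrix.posSemidef_sum _ fun x _ => hτ.submatrix _

lemma trRight_posSemidef {τ : Matrix (X × Y) (X × Y) ℂ} (hτ : τ.PosSemidef) :
    (trRight τ).PosSemidef := by
  have h : trRight τ = ∑ y, τ.submatrix (fun x => (x, y)) fun x => (x, y) := by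
    ext x x'
    simp [trRight, Matrix.sum_apply]
  rw [h]
  exact Matrix.posSemidef_sum _ fun y _ => hτ.submatrix _

lemma isDensity_trRight {τ : Matrix (X × Y) (X × Y) ℂ} (hτ : IsDensity τ) :
    IsDensity (trRight τ) := by
  refine ⟨trRight_posSemidef hτ.1, ?_⟩
  have h := trace_kronecker_one_mul 1 τ
  rw [Matrix.one_kronecker_one, Matrix.one_mul, Matrix.one_mul] at h
  rw [← h, hτ.2]

lemma trLeft_measureLeft (τ : Matrix (X × Y) (X × Y) ℂ) : trLeft (measureLeft τ) = trLeft τ := by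
  ext y y'
  simp [trLeft, measureLeft]

lemma evolve_posSemidef {Z : Type*} [Fintype Z] {ρ : Matrix X X ℂ} (hρ : ρ.PosSemidef)
    (G : Matrix Z X ℂ) :
    (evolve G ρ).PosSemidef :=
  hρ.mul_mul_conjTranspose_same G

lemma trace_mul_evolve {Z : Type*} [Fintype Z] (A : Matrix Z Z ℂ) (G : Matrix Z X ℂ)
    (ρ : Matrix X X ℂ) : (A * evolve G ρ).trace = (Gᴴ * A * G * ρ).trace := by
  rw [evolve, ← Matrix.mul_assoc, Matrix.trace_mul_comm]
  simp only [Matrix.mul_assoc]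

lemma expect_eq_trace (M : Matrix X E ℂ) (A : Matrix X X ℂ) :
    expect M A = (A * (M * Mᴴ)).trace := by
  rw [expect, Matrix.mul_assoc, Matrix.trace_mul_comm, Matrix.mul_assoc]

lemma expect_submatrix {Z : Type*} [Fintype Z] [DecidableEq Z] (b : Z ≃ X) (M : Matrix X E ℂ)
    (A : Matrix X X ℂ) : expect (M.submatrix b id) (A.submatrix b b) = expect M A := by
  rw [expect, expect, Matrix.conjTranspose_submatrix, Matrix.submatrix_mul_equiv,
    Matrix.submatrix_mul_equiv, Matrix.submatrix_id_id]

lemma re_mul_conjTranspose_diag_nonneg (M : Matrix X E ℂ) (x : X) : 0 ≤ ((M * Mᴴ) x x).re :=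
  (Complex.le_def.1 ((Matrix.posSemidef_self_mul_conjTranspose M).diag_nonneg (i := x))).1

/-- The expectation of a diagonal observable with values `±1` is at least `2 p - 1` if `p` is the
probability of a set of outcomes on which its value is `1`. -/
lemma two_mul_sum_le_expect_diagonal {M : Matrix X E ℂ} (hM : (Mᴴ * M).trace = 1)
    (good : X → Prop) [DecidablePred good] (d : X → Bool) (hd : ∀ x, good x → d x = false) :
    2 * (∑ x, if good x then ((M * Mᴴ) x x).re else 0) - 1 ≤
      (expect M (Matrix.diagonal fun x => if d x then (-1 : ℂ) else 1)).re := by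
  have h1 : (1 : ℝ) = ∑ x, ((M * Mᴴ) x x).re := by
    rw [Matrix.trace_mul_comm] at hM
    have := congrArg Complex.re hM
    simpa [Matrix.trace] using this.symm
  rw [h1, expect_eq_trace, Matrix.trace, Complex.re_sum, Finset.mul_sum, ← Finset.sum_sub_distrib]
  refine Finset.sum_le_sum fun x _ => ?_
  have h2 := re_mul_conjTranspose_diag_nonneg M x
  rw [Matrix.diag_apply, Matrix.diagonal_mul]
  by_cases hx : good x
  · simp only [hx, if_true, hd x hx]
    simp only [Bool.false_eq_true, if_false, one_mul]
    linarith
  · rw [if_neg hx]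
    split_ifs <;> simp only [one_mul, neg_mul, Complex.neg_re] <;> linarith

lemma sum_good_le_one {M : Matrix X E ℂ} (hM : (Mᴴ * M).trace = 1) (good : X → Prop)
    [DecidablePred good] : (∑ x, if good x then ((M * Mᴴ) x x).re else 0) ≤ 1 := by
  have h1 : (1 : ℝ) = ∑ x, ((M * Mᴴ) x x).re := by
    rw [Matrix.trace_mul_comm] at hM
    have := congrArg Complex.re hM
    simpa [Matrix.trace] using this.symm
  rw [h1]
  refine Finset.sum_le_sum fun x _ => ?_
  have h2 := re_mul_conjTranspose_diag_nonneg M x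
  split_ifs <;> linarith

end PartialTrace

/-! ### The circuit in the Heisenberg picture -/

section Heisenberg

variable {n m : ℕ} {H A B K : Type*} [Fintype H] [DecidableEq H] [Fintype A] [DecidableEq A]
  [Fintype B] [DecidableEq B] [Fintype K] [DecidableEq K]

/-- The observable whose expectation before the application of the unitaries in the list `l` is that
of `O` after it. -/
def pullback {D : Type*} [Fintype D] [DecidableEq D] (l : List (Matrix.unitaryGroup D ℂ))
    (O : Matrix D D ℂ) : Matrix D D ℂ :=
  l.foldr (fun V O => (V : Matrix D D ℂ)ᴴ * O * (V : Matrix D D ℂ)) O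

section Pullback

variable {D : Type*} [Fintype D] [DecidableEq D]

lemma unitary_conjTranspose_mul_self (V : Matrix.unitaryGroup D ℂ) :
    (V : Matrix D D ℂ)ᴴ * (V : Matrix D D ℂ) = 1 :=
  Unitary.coe_star_mul_self V

lemma trace_mul_foldl_evolve (l : List (Matrix.unitaryGroup D ℂ)) (O σ : Matrix D D ℂ) :
    (O * l.foldl (fun σ (V : Matrix.unitaryGroup D ℂ) => evolve (V : Matrix D D ℂ) σ) σ).trace =
      (pullback l O * σ).trace := by
  induction l generalizing σ with
  | nil => rfl
  | cons V l ih =>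
    rw [List.foldl_cons, ih, trace_mul_evolve]
    rfl

lemma foldl_evolve_posSemidef (l : List (Matrix.unitaryGroup D ℂ)) {σ : Matrix D D ℂ}
    (hσ : σ.PosSemidef) :
    (l.foldl (fun σ (V : Matrix.unitaryGroup D ℂ) =>
      evolve (V : Matrix D D ℂ) σ) σ).PosSemidef := by
  induction l generalizing σ with
  | nil => exact hσ
  | cons V l ih => exact ih (evolve_posSemidef hσ _)

lemma pullback_isReflection (l : List (Matrix.unitaryGroup D ℂ)) {O : Matrix D D ℂ}
    (hO : IsReflection O) : IsReflection (pullback l O) := by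
  induction l with
  | nil => exact hO
  | cons V l ih => exact ih.conj (unitary_conjTranspose_mul_self V)

lemma pullback_one (l : List (Matrix.unitaryGroup D ℂ)) : pullback l (1 : Matrix D D ℂ) = 1 := by
  induction l with
  | nil => rfl
  | cons V l ih =>
    change (V : Matrix D D ℂ)ᴴ * pullback l 1 * (V : Matrix D D ℂ) = 1
    rw [ih, Matrix.mul_one, unitary_conjTranspose_mul_self]

lemma pullback_drop (U : Fin n → Matrix.unitaryGroup D ℂ) (O : Matrix D D ℂ) (j : Fin n) :
    pullback ((List.ofFn U).drop j) O = (U j : Matrix D D ℂ)ᴴ *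
      pullback ((List.ofFn U).drop (j + 1)) O * (U j : Matrix D D ℂ) := by
  rw [List.drop_eq_getElem_cons (by simp), List.getElem_ofFn]
  rfl

end Pullback

/-- The observable on `H ⊗ A` that an observable on the output of a circuit stands for. -/
def Circuit.outputObservable (Q : Circuit n H A B K) (S : Matrix K K ℂ) :
    Matrix (H × A) (H × A) ℂ :=
  ((1 : Matrix B B ℂ) ⊗ₖ S).submatrix Q.split Q.split

lemma Circuit.outputObservable_isReflection (Q : Circuit n H A B K) {S : Matrix K K ℂ}
    (hS : IsReflection S) : IsReflection (Q.outputObservable S) := by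
  constructor
  · rw [outputObservable, Matrix.conjTranspose_submatrix, Matrix.conjTranspose_kronecker,
      Matrix.conjTranspose_one, hS.conjTranspose_eq]
  · rw [outputObservable, Matrix.submatrix_mul_equiv, ← Matrix.mul_kronecker_mul, Matrix.one_mul,
      hS.mul_self, Matrix.one_kronecker_one, Matrix.submatrix_one_equiv]

lemma Circuit.run_eq (Q : Circuit n H A B K) (ρ : Matrix H H ℂ) :
    Q.run ρ = trLeft (((List.ofFn Q.U).foldl (fun σ (V : Matrix.unitaryGroup (H × A) ℂ) =>
      evolve (V : Matrix (H × A) (H × A) ℂ) σ) (evolve (basisMap fun h => (h, Q.zero)) ρ)).submatrix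
        Q.split.symm Q.split.symm) := by
  have h : ∀ (l : List (Matrix.unitaryGroup (H × A) ℂ)) (σ : Matrix (H × A) (H × A) ℂ),
      (l.flatMap fun V : Matrix.unitaryGroup (H × A) ℂ => [(V : Matrix (H × A) (H × A) ℂ)]).foldl
          (fun σ V => evolve V σ) σ =
        l.foldl (fun σ (V : Matrix.unitaryGroup (H × A) ℂ) =>
          evolve (V : Matrix (H × A) (H × A) ℂ) σ) σ := fun l σ => by
    rw [← List.map_eq_flatMap, List.foldl_map]
  rw [← h]
  rfl

lemma Circuit.trace_mul_run (Q : Circuit n H A B K) (S : Matrix K K ℂ) (ρ : Matrix H H ℂ) :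
    (S * Q.run ρ).trace = (pullback (List.ofFn Q.U) (Q.outputObservable S) *
      evolve (basisMap fun h => (h, Q.zero)) ρ).trace := by
  rw [← trace_mul_foldl_evolve, run_eq, ← trace_one_kronecker_mul, outputObservable]
  generalize List.foldl _ _ _ = σ
  have h : σ = (σ.submatrix Q.split.symm Q.split.symm).submatrix Q.split Q.split := by
    ext x y; simp
  conv_rhs => rw [h, Matrix.submatrix_mul_equiv]
  exact (Equiv.sum_comp Q.split fun x => _).symm

lemma basisMap_conjTranspose_mul_mul {X Y : Type*} [Fintype Y] [DecidableEq Y] (f : X → Y)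
    (N : Matrix Y Y ℂ) : (basisMap f)ᴴ * N * basisMap f = N.submatrix f f := by
  ext x x'
  simp [basisMap, Matrix.mul_apply, apply_ite]

lemma basisMap_isometry {X Y : Type*} [Fintype Y] [DecidableEq X] [DecidableEq Y] {f : X → Y}
    (hf : f.Injective) : (basisMap f)ᴴ * basisMap f = 1 := by
  ext x x'
  simp only [basisMap, Matrix.mul_apply, Matrix.conjTranspose_apply, Matrix.one_apply,
    apply_ite star, star_one, star_zero, mul_ite, mul_one, mul_zero, Finset.sum_ite_eq',
    Finset.mem_univ, if_true]
  exact if_congr (by rw [hf.eq_iff, eq_comm]) rfl rfl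

lemma Circuit.run_isDensity (Q : Circuit n H A B K) {ρ : Matrix H H ℂ} (hρ : IsDensity ρ) :
    IsDensity (Q.run ρ) := by
  refine ⟨Q.run_eq ρ ▸ trLeft_posSemidef
    ((foldl_evolve_posSemidef _ (evolve_posSemidef hρ.1 _)).submatrix _), ?_⟩
  have h1 : Q.outputObservable (1 : Matrix K K ℂ) = 1 := by
    rw [outputObservable, Matrix.one_kronecker_one, Matrix.submatrix_one_equiv]
  have hinj : Function.Injective fun h : H => (h, Q.zero) := fun a b h => (Prod.ext_iff.1 h).1
  have h := Q.trace_mul_run 1 ρ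
  rwa [h1, pullback_one, trace_mul_evolve, Matrix.mul_one, basisMap_isometry hinj, Matrix.one_mul,
    Matrix.one_mul, hρ.2] at h

end Heisenberg

/-! ### The parallelized circuit on its cells -/

section Parallel

variable {m : ℕ} {H A B K : Type*} [Fintype H] [DecidableEq H] [Fintype A] [DecidableEq A]
  [Fintype B] [DecidableEq B] [Fintype K] [DecidableEq K]

/-- The cells of the parallelized circuit: one for each piece, and an auxiliary one for each
interface. -/
abbrev CircuitCells (m : ℕ) (H A : Type*) : Type _ :=
  Cells (Fin m) (Fin (m + 1) ⊕ Fin m) (H × A)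

/-- The identification of the registers of the parallelized circuit with a family of cells. -/
def cellsEquiv (m : ℕ) (H A : Type*) : Registers m H A ≃ CircuitCells m H A where
  toFun x := (x.1, x.2.1, x.2.2.1, Sum.elim x.2.2.2.1 x.2.2.2.2)
  invFun x := (x.1, x.2.1, x.2.2.1, x.2.2.2 ∘ Sum.inl, x.2.2.2 ∘ Sum.inr)
  left_inv _ := rfl
  right_inv x := by simp

lemma cellsEquiv_apply (c t u : Fin m → Bool) (R : Fin (m + 1) → H × A) (S : Fin m → H × A) :
    cellsEquiv m H A (c, t, u, R, S) = (c, t, u, Sum.elim R S) := rfl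

lemma cellsEquiv_symm_apply (c t u : Fin m → Bool) (z : Fin (m + 1) ⊕ Fin m → H × A) :
    (cellsEquiv m H A).symm (c, t, u, z) = (c, t, u, z ∘ Sum.inl, z ∘ Sum.inr) := rfl

lemma sum_elim_inj {X Y D : Type*} {f f' : X → D} {g g' : Y → D} :
    Sum.elim f g = Sum.elim f' g' ↔ f = f' ∧ g = g' :=
  ⟨fun h => ⟨funext fun x => congrFun h (Sum.inl x), funext fun y => congrFun h (Sum.inr y)⟩,
    fun h => by rw [h.1, h.2]⟩

lemma one_elim_apply (R R' : Fin (m + 1) → H × A) (S S' : Fin m → H × A) :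
    (1 : Matrix (Fin (m + 1) ⊕ Fin m → H × A) (Fin (m + 1) ⊕ Fin m → H × A) ℂ)
      (Sum.elim R S) (Sum.elim R' S') =
      (1 : Matrix _ _ ℂ) R R' * (1 : Matrix _ _ ℂ) S S' := by
  simp only [Matrix.one_apply, sum_elim_inj]
  split_ifs <;> simp_all

lemma quad_submatrix_cellsEquiv (a b e : QubitOp (Fin m)) :
    (quad a b e 1 : Matrix (CircuitCells m H A) (CircuitCells m H A) ℂ).submatrix
      (cellsEquiv m H A) (cellsEquiv m H A) = a ⊗ₖ (b ⊗ₖ (e ⊗ₖ (1 ⊗ₖ 1))) := by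
  ext ⟨c, t, u, R, S⟩ ⟨c', t', u', R', S'⟩
  have h := one_elim_apply R R' S S'
  simp only [Matrix.submatrix_apply, quad_apply, cellsEquiv_apply, Matrix.kroneckerMap_apply, h]

lemma quad_pieces_submatrix_cellsEquiv (a b e : QubitOp (Fin m))
    (U : Fin (m + 1) → Matrix (H × A) (H × A) ℂ) :
    (quad a b e (tensor (Sum.elim U fun _ => 1)) :
      Matrix (CircuitCells m H A) (CircuitCells m H A) ℂ).submatrix
      (cellsEquiv m H A) (cellsEquiv m H A) = a ⊗ₖ (b ⊗ₖ (e ⊗ₖ (tensor U ⊗ₖ 1))) := by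
  ext ⟨c, t, u, R, S⟩ ⟨c', t', u', R', S'⟩
  simp only [Matrix.submatrix_apply, quad_apply, cellsEquiv_apply,
    Matrix.kroneckerMap_apply]
  congr 3
  rw [← tensor_one]
  simp only [tensor, Fintype.prod_sum_type, Sum.elim_inl, Sum.elim_inr]

lemma basisMap_submatrix_equiv {X Y : Type*} [DecidableEq X] [DecidableEq Y] (b : X ≃ Y)
    (f : Y → Y) : (basisMap f).submatrix b b = basisMap (b.symm ∘ f ∘ b) := by
  ext x y
  simp only [basisMap, Matrix.submatrix_apply, Function.comp_apply]
  exact if_congr (b.eq_symm_apply).symm rfl rfl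

lemma firstLayer_submatrix_cellsEquiv :
    (firstLayer (H × A) (Fin.succ : Fin m → Fin (m + 1))).submatrix
      (cellsEquiv m H A) (cellsEquiv m H A) = controlledSwapFirst m H A := by
  have hs : Function.Injective (Fin.succ : Fin m → Fin (m + 1)) := Fin.succ_injective m
  rw [firstLayer, swapLayer, basisMap_submatrix_equiv, controlledSwapFirst]
  congr 1
  funext ⟨c, t, u, R, S⟩
  simp only [Function.comp_apply, cellsEquiv_apply, cellsEquiv_symm_apply, Prod.mk.injEq,
    true_and]
  constructor
  · funext j
    refine Fin.cases ?_ (fun i => ?_) j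
    · rw [Function.comp_apply, Function.comp_apply, exchange_inl_of_notMem _ (by simp)]
      simp
    · rw [Function.comp_apply, Function.comp_apply, exchange_inl_apply hs]
      split_ifs with h <;> simp_all
  · funext i
    rw [Function.comp_apply, Function.comp_apply, exchange_inr]
    split_ifs with h <;> simp

lemma secondLayer_submatrix_cellsEquiv :
    (secondLayer (H × A) (Fin.castSucc : Fin m → Fin (m + 1))).submatrix
      (cellsEquiv m H A) (cellsEquiv m H A) = controlledSwapSecond m H A := by
  have hs : Function.Injective (Fin.castSucc : Fin m → Fin (m + 1)) := Fin.castSucc_injective m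
  rw [secondLayer, swapLayer, basisMap_submatrix_equiv, controlledSwapSecond]
  congr 1
  funext ⟨c, t, u, R, S⟩
  simp only [Function.comp_apply, cellsEquiv_apply, cellsEquiv_symm_apply, Prod.mk.injEq,
    true_and]
  constructor
  · funext j
    refine Fin.lastCases ?_ (fun i => ?_) j
    · rw [Function.comp_apply, Function.comp_apply, exchange_inl_of_notMem _ (by
        rintro ⟨i, hi⟩; exact (Fin.castSucc_lt_last i).ne hi)]
      simp
    · rw [Function.comp_apply, Function.comp_apply, exchange_inl_apply hs]
      split_ifs with h <;> simp_all
  · funext i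
    rw [Function.comp_apply, Function.comp_apply, exchange_inr]
    split_ifs with h <;> simp

/-- The pieces of a circuit as matrices. -/
def Circuit.mats {n : ℕ} (Q : Circuit n H A B K) (j : Fin n) : Matrix (H × A) (H × A) ℂ := Q.U j

lemma Circuit.mats_isometry {n : ℕ} (Q : Circuit n H A B K) (j : Fin n) :
    (Q.mats j)ᴴ * Q.mats j = 1 :=
  unitary_conjTranspose_mul_self _

lemma Circuit.parallelUnitary_eq (Q : Circuit (m + 1) H A B K) :
    Q.parallelUnitary =
      (secondTests (H × A) Fin.castSucc * (flipAndPieces (Fin m) Q.mats *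
        (firstTests (H × A) Fin.succ * quad (hadamards (Fin m)) 1 1 1))).submatrix
          (cellsEquiv m H A) (cellsEquiv m H A) := by
  have e1 : hadamardFirst m H A = (quad 1 (hadamards (Fin m)) 1 1).submatrix
      (cellsEquiv m H A) (cellsEquiv m H A) := by
    rw [quad_submatrix_cellsEquiv]; simp only [Matrix.one_kronecker_one]; rfl
  have e2 : hadamardSecond m H A = (quad 1 1 (hadamards (Fin m)) 1).submatrix
      (cellsEquiv m H A) (cellsEquiv m H A) := by
    rw [quad_submatrix_cellsEquiv]; simp only [Matrix.one_kronecker_one]; rfl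
  have e3 : hadamardControls m H A = (quad (hadamards (Fin m)) 1 1 1).submatrix
      (cellsEquiv m H A) (cellsEquiv m H A) := by
    rw [quad_submatrix_cellsEquiv]; simp only [Matrix.one_kronecker_one]; rfl
  have e4 : Q.pieces * flipControls m H A = (flipAndPieces (Fin m) Q.mats).submatrix
      (cellsEquiv m H A) (cellsEquiv m H A) := by
    have h4 : flipControls m H A = (quad (nots (Fin m)) 1 1 1).submatrix
        (cellsEquiv m H A) (cellsEquiv m H A) := by
      rw [quad_submatrix_cellsEquiv]; simp only [Matrix.one_kronecker_one]; rfl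
    have h5 : Q.pieces = (quad 1 1 1 (tensor (Sum.elim Q.mats fun _ => 1))).submatrix
        (cellsEquiv m H A) (cellsEquiv m H A) := by
      rw [quad_pieces_submatrix_cellsEquiv]; rfl
    rw [h4, h5, Matrix.submatrix_mul_equiv, quad_mul, flipAndPieces]
    simp only [Matrix.one_mul, Matrix.mul_one]
  rw [parallelUnitary, Matrix.mul_assoc (secondSwapTests m H A), e4, firstSwapTests,
    secondSwapTests, e1, e2, e3, ← firstLayer_submatrix_cellsEquiv,
    ← secondLayer_submatrix_cellsEquiv]
  simp only [Matrix.submatrix_mul_equiv, firstTests, secondTests, Matrix.mul_assoc]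

/-- The preparation of the registers, as an operator into the space of the cells. -/
def prepareCells (m : ℕ) (H : Type*) {A : Type*} [DecidableEq H] [DecidableEq A] (zero : A) :
    Matrix (CircuitCells m H A) (Input m H A) ℂ :=
  basisMap fun x => (fun _ => false, fun _ => false, fun _ => false,
    Sum.elim (Fin.cons (x.1, zero) x.2.1) x.2.2)

lemma prepareCells_injective (zero : A) :
    Function.Injective fun x : Input m H A =>
      ((fun _ => false, fun _ => false, fun _ => false,
        Sum.elim (Fin.cons (x.1, zero) x.2.1) x.2.2) : CircuitCells m H A) := by
  rintro ⟨h, r, a⟩ ⟨h', r', a'⟩ hx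
  simp only [Prod.mk.injEq, true_and, sum_elim_inj, Fin.cons_inj] at hx
  obtain ⟨⟨h1, h2⟩, h3⟩ := hx
  simp [h1.1, h2, h3]

lemma prepare_eq (zero : A) :
    prepare m zero = (prepareCells m H zero).submatrix (cellsEquiv m H A) id := by
  ext x y
  simp only [prepare, prepareCells, basisMap, Matrix.submatrix_apply, id]
  exact if_congr ((cellsEquiv m H A).injective.eq_iff).symm rfl rfl

/-- The state of the cells of a parallelized circuit before the first tests, on the input state with
square root `R`. -/
def readyState (zero : A) (R : Matrix (Input m H A) (Input m H A) ℂ) :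
    Matrix (CircuitCells m H A) (Input m H A) ℂ :=
  (quad (hadamards (Fin m)) 1 1 1 : Matrix (CircuitCells m H A) (CircuitCells m H A) ℂ) *
    (prepareCells m H zero * R)

lemma diagonal_mul_basisMap {X Y : Type*} [Fintype Y] [DecidableEq Y] (d : Y → ℂ) (f : X → Y)
    (h : ∀ x, d (f x) = 1) : Matrix.diagonal d * basisMap f = basisMap f := by
  ext y x
  rw [Matrix.diagonal_mul, basisMap]
  split_ifs with hy
  · rw [hy, h, mul_one]
  · rw [mul_zero]

section Quad

variable {ι Q D : Type*} [Fintype ι] [DecidableEq ι] [Fintype Q] [DecidableEq Q] [Fintype D]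
  [DecidableEq D]

lemma quad_signAt_control (i : ι) : (quad (signAt i) 1 1 1 : Matrix (Cells ι Q D) _ ℂ) =
    Matrix.diagonal fun x => if x.1 i then -1 else 1 := by
  ext ⟨c, t, u, z⟩ ⟨c', t', u', z'⟩
  simp only [quad_apply, signAt_apply, Matrix.one_apply, Matrix.diagonal_apply, Prod.mk.injEq]
  split_ifs <;> simp_all

lemma quad_signAt_first (i : ι) : (quad 1 (signAt i) 1 1 : Matrix (Cells ι Q D) _ ℂ) =
    Matrix.diagonal fun x => if x.2.1 i then -1 else 1 := by
  ext ⟨c, t, u, z⟩ ⟨c', t', u', z'⟩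
  simp only [quad_apply, signAt_apply, Matrix.one_apply, Matrix.diagonal_apply, Prod.mk.injEq]
  split_ifs <;> simp_all

lemma quad_signAt_second (i : ι) : (quad 1 1 (signAt i) 1 : Matrix (Cells ι Q D) _ ℂ) =
    Matrix.diagonal fun x => if x.2.2.1 i then -1 else 1 := by
  ext ⟨c, t, u, z⟩ ⟨c', t', u', z'⟩
  simp only [quad_apply, signAt_apply, Matrix.one_apply, Matrix.diagonal_apply, Prod.mk.injEq]
  split_ifs <;> simp_all

end Quad

lemma readyState_isReady (zero : A) {R : Matrix (Input m H A) (Input m H A) ℂ}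
    (hR : (Rᴴ * R).trace = 1) : IsReady (readyState zero R) where
  trace_eq_one := by
    have h : (quad (hadamards (Fin m)) 1 1 1 : Matrix (CircuitCells m H A) _ ℂ)ᴴ *
        quad (hadamards (Fin m)) 1 1 1 = 1 := by
      rw [quad_conjTranspose, quad_mul, hadamards_conjTranspose, hadamards_mul_self]
      simp only [Matrix.conjTranspose_one, Matrix.mul_one, quad_one]
    rw [readyState, trace_isometry_mul h, trace_isometry_mul, hR]
    exact basisMap_isometry (prepareCells_injective zero)
  control i := by
    have h : notAt i * hadamards (Fin m) = hadamards (Fin m) * signAt i := by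
      rw [← hadamards_conj_signAt, Matrix.mul_assoc, hadamards_mul_self, Matrix.mul_one]
    have h' : (quad (signAt i) 1 1 1 : Matrix (CircuitCells m H A) (CircuitCells m H A) ℂ) *
        prepareCells m H zero = prepareCells m H zero := by
      rw [quad_signAt_control]
      exact diagonal_mul_basisMap _ _ fun x => by simp
    rw [readyState, ← Matrix.mul_assoc, quad_mul, h]
    have h2 : quad (hadamards (Fin m) * signAt i) (1 * 1) (1 * 1) (1 * 1) =
        (quad (hadamards (Fin m)) 1 1 1 * quad (signAt i) 1 1 1 :
          Matrix (CircuitCells m H A) (CircuitCells m H A) ℂ) := by rw [quad_mul]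
    rw [h2, Matrix.mul_assoc, ← Matrix.mul_assoc (quad (signAt i) 1 1 1), h']
  first i := by
    have h : (quad 1 (signAt i) 1 1 : Matrix (CircuitCells m H A) (CircuitCells m H A) ℂ) *
        prepareCells m H zero = prepareCells m H zero := by
      rw [quad_signAt_first]
      exact diagonal_mul_basisMap _ _ fun x => by simp
    have h2 : (quad 1 (signAt i) 1 1 * quad (hadamards (Fin m)) 1 1 1 :
        Matrix (CircuitCells m H A) (CircuitCells m H A) ℂ) =
        quad (hadamards (Fin m)) 1 1 1 * quad 1 (signAt i) 1 1 := by
      simp only [quad_mul, Matrix.one_mul, Matrix.mul_one]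
    rw [readyState, ← Matrix.mul_assoc, h2, Matrix.mul_assoc,
      ← Matrix.mul_assoc (quad 1 (signAt i) 1 1), h]
  second i := by
    have h : (quad 1 1 (signAt i) 1 : Matrix (CircuitCells m H A) (CircuitCells m H A) ℂ) *
        prepareCells m H zero = prepareCells m H zero := by
      rw [quad_signAt_second]
      exact diagonal_mul_basisMap _ _ fun x => by simp
    have h2 : (quad 1 1 (signAt i) 1 * quad (hadamards (Fin m)) 1 1 1 :
        Matrix (CircuitCells m H A) (CircuitCells m H A) ℂ) =
        quad (hadamards (Fin m)) 1 1 1 * quad 1 1 (signAt i) 1 := by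
      simp only [quad_mul, Matrix.one_mul, Matrix.mul_one]
    rw [readyState, ← Matrix.mul_assoc, h2, Matrix.mul_assoc,
      ← Matrix.mul_assoc (quad 1 1 (signAt i) 1), h]

/-- An observable on the cell of the first piece only sees the first part of the input. -/
lemma expect_readyState_onCell_zero (zero : A) (R : Matrix (Input m H A) (Input m H A) ℂ)
    (O : Matrix (H × A) (H × A) ℂ) :
    expect (readyState zero R) (onCell (Fin m) (Sum.inl 0) O) =
      (O * evolve (basisMap fun h => (h, zero)) (trRight (R * Rᴴ))).trace := by
  have h1 : (quad (hadamards (Fin m)) 1 1 1 : Matrix (CircuitCells m H A) _ ℂ)ᴴ *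
      onCell (Fin m) (Sum.inl 0) O * quad (hadamards (Fin m)) 1 1 1 =
        onCell (Fin m) (Sum.inl 0) O := by
    rw [quad_conjTranspose, onCell, quad_mul, quad_mul, hadamards_conjTranspose, Matrix.mul_one,
      hadamards_mul_self]
    simp only [Matrix.conjTranspose_one, Matrix.one_mul, Matrix.mul_one]
  have h2 : (prepareCells m H zero)ᴴ * onCell (Fin m) (Sum.inl 0 : Fin (m + 1) ⊕ Fin m) O *
      prepareCells m H zero =
      ((basisMap fun h : H => (h, zero))ᴴ * O * basisMap fun h : H => (h, zero)) ⊗ₖ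
        (1 : Matrix ((Fin m → H × A) × (Fin m → H × A)) _ ℂ) := by
    rw [prepareCells, basisMap_conjTranspose_mul_mul, basisMap_conjTranspose_mul_mul]
    ext ⟨h, r, a⟩ ⟨h', r', a'⟩
    simp only [Matrix.submatrix_apply, onCell, quad_apply, Matrix.one_apply_eq, one_mul,
      atSite_apply, Matrix.kroneckerMap_apply, Matrix.one_apply, Sum.elim_inl, Fin.cons_zero,
      mul_ite, mul_one, mul_zero]
    refine if_congr ⟨fun hx => ?_, fun hx => ?_⟩ rfl rfl
    · refine Prod.ext (funext fun i => ?_) (funext fun i => ?_)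
      · simpa using hx (Sum.inl i.succ) (by simp)
      · simpa using hx (Sum.inr i) (by simp)
    · simp only [Prod.mk.injEq] at hx
      obtain ⟨rfl, rfl⟩ := hx
      rintro (j | i) hj
      · obtain ⟨k, rfl⟩ := Fin.exists_succ_eq.2 fun h0 : j = 0 => hj (by rw [h0])
        simp
      · rfl
  rw [readyState, expect_mul, h1, expect_mul, h2, expect_eq_trace, trace_kronecker_one_mul,
    trace_mul_evolve]

end Parallel

/-! ### The output of the parallelized circuit -/

section Output

variable {m : ℕ} {H A B K : Type*} [Fintype H] [DecidableEq H] [Fintype A] [DecidableEq A]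
  [Fintype B] [DecidableEq B] [Fintype K] [DecidableEq K]

/-- The basis of the space that is traced out at the end of the parallelized circuit. -/
abbrev Discarded (m : ℕ) (H A B : Type*) : Type _ :=
  (Fin m → Bool) × (Fin m → H × A) × B × (Fin m → H × A)

/-- The arrangement of the registers into discarded registers and outputs, as an equivalence. -/
def Circuit.arrangeEquiv (Q : Circuit (m + 1) H A B K) :
    Discarded m H A B × (Tests m × K) ≃ Registers m H A where
  toFun := Q.arrange
  invFun x := ((x.1, Fin.init x.2.2.2.1, (Q.split (x.2.2.2.1 (Fin.last m))).1, x.2.2.2.2),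
    ((x.2.1, x.2.2.1), (Q.split (x.2.2.2.1 (Fin.last m))).2))
  left_inv := fun ((c, R, b, S), ((t, u), k)) => by
    simp [Circuit.arrange]
  right_inv := fun (c, t, u, R, S) => by
    simp [Circuit.arrange]

/-- The first swap tests of the parallelized circuit, on its cells. -/
abbrev firstTestsCells (m : ℕ) (H A : Type*) [Fintype H] [DecidableEq H] [Fintype A]
    [DecidableEq A] : Matrix (CircuitCells m H A) (CircuitCells m H A) ℂ :=
  firstTests (H × A) (Fin.succ : Fin m → Fin (m + 1))

/-- The second swap tests of the parallelized circuit, on its cells. -/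
abbrev secondTestsCells (m : ℕ) (H A : Type*) [Fintype H] [DecidableEq H] [Fintype A]
    [DecidableEq A] : Matrix (CircuitCells m H A) (CircuitCells m H A) ℂ :=
  secondTests (H × A) (Fin.castSucc : Fin m → Fin (m + 1))

/-- The not gates and the pieces of the parallelized circuit, on its cells. -/
abbrev Circuit.piecesCells (Q : Circuit (m + 1) H A B K) :
    Matrix (CircuitCells m H A) (CircuitCells m H A) ℂ :=
  flipAndPieces (Fin m) Q.mats

/-- The final state of the cells of the parallelized circuit, on the input state with square root
`R`. -/
def Circuit.finalState (Q : Circuit (m + 1) H A B K)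
    (R : Matrix (Input m H A) (Input m H A) ℂ) : Matrix (CircuitCells m H A) (Input m H A) ℂ :=
  secondTestsCells m H A * (Q.piecesCells * (firstTestsCells m H A * readyState Q.zero R))

/-- The final state of the parallelized circuit, with its registers arranged into discarded ones and
outputs. -/
def Circuit.arrangedState (Q : Circuit (m + 1) H A B K)
    (R : Matrix (Input m H A) (Input m H A) ℂ) :
    Matrix (Discarded m H A B × (Tests m × K)) (Input m H A) ℂ :=
  (Q.finalState R).submatrix (Q.arrangeEquiv.trans (cellsEquiv m H A)) id

lemma Circuit.parallelRun_eq (Q : Circuit (m + 1) H A B K)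
    (R : Matrix (Input m H A) (Input m H A) ℂ) :
    Q.parallelRun (R * Rᴴ) =
      measureLeft (trLeft (Q.arrangedState R * (Q.arrangedState R)ᴴ)) := by
  set P : Matrix (Registers m H A) (Input m H A) ℂ := prepare m Q.zero with hP
  have h : Q.parallelUnitary * P * R =
      (Q.finalState R).submatrix (cellsEquiv m H A) id := by
    rw [Q.parallelUnitary_eq, hP, prepare_eq, Matrix.submatrix_mul_equiv]
    have h2 : ∀ N : Matrix (CircuitCells m H A) (Input m H A) ℂ,
        N.submatrix (cellsEquiv m H A) id * R = (N * R).submatrix (cellsEquiv m H A) id :=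
      fun N => rfl
    rw [h2, finalState, readyState]
    simp only [Matrix.mul_assoc]
  have h3 : evolve Q.parallelUnitary (evolve P (R * Rᴴ)) =
      (Q.parallelUnitary * P * R) *
        (Q.parallelUnitary * P * R)ᴴ := by
    simp only [evolve, Matrix.conjTranspose_mul, Matrix.mul_assoc]
  rw [parallelRun, ← hP, h3, h]
  rfl

lemma Circuit.trace_arrangedState (Q : Circuit (m + 1) H A B K)
    {R : Matrix (Input m H A) (Input m H A) ℂ} (hR : (Rᴴ * R).trace = 1) :
    ((Q.arrangedState R)ᴴ * Q.arrangedState R).trace = 1 := by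
  rw [arrangedState, Matrix.conjTranspose_submatrix, Matrix.submatrix_mul_equiv,
    Matrix.submatrix_id_id, finalState,
    trace_isometry_mul (secondTests_isometry (Fin.castSucc_injective m)),
    trace_isometry_mul (flipAndPieces_isometry Q.mats_isometry),
    trace_isometry_mul (firstTests_isometry (Fin.succ_injective m)),
    (readyState_isReady Q.zero hR).trace_eq_one]

/-- The probability that all the swap tests of the parallelized circuit succeed. -/
def Circuit.passProbability (Q : Circuit (m + 1) H A B K)
    (ρ : Matrix (Input m H A) (Input m H A) ℂ) : ℝ :=
  ∑ k, (Q.parallelRun ρ ((fun _ => false, fun _ => false), k)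
    ((fun _ => false, fun _ => false), k)).re

lemma Circuit.passProbability_eq (Q : Circuit (m + 1) H A B K)
    (R : Matrix (Input m H A) (Input m H A) ℂ) :
    Q.passProbability (R * Rᴴ) = ∑ x, if x.2.1 = ((fun _ => false, fun _ => false) : Tests m) then
      ((Q.arrangedState R * (Q.arrangedState R)ᴴ) x x).re else 0 := by
  rw [passProbability, parallelRun_eq, Fintype.sum_prod_type, Finset.sum_comm,
    Fintype.sum_prod_type, Finset.sum_comm]
  refine Finset.sum_congr rfl fun k _ => ?_
  rw [Finset.sum_comm]
  simp only [measureLeft, trLeft, if_true, Complex.re_sum, Finset.sum_ite_eq', Finset.mem_univ]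

lemma Circuit.passProbability_nonneg (Q : Circuit (m + 1) H A B K)
    (R : Matrix (Input m H A) (Input m H A) ℂ) : 0 ≤ Q.passProbability (R * Rᴴ) := by
  rw [passProbability_eq]
  refine Finset.sum_nonneg fun x _ => ?_
  split_ifs
  · exact re_mul_conjTranspose_diag_nonneg _ x
  · exact le_rfl

lemma Circuit.passProbability_le_one (Q : Circuit (m + 1) H A B K)
    {R : Matrix (Input m H A) (Input m H A) ℂ} (hR : (Rᴴ * R).trace = 1) :
    Q.passProbability (R * Rᴴ) ≤ 1 := by
  rw [passProbability_eq]
  exact sum_good_le_one (Q.trace_arrangedState hR) _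

lemma Circuit.le_expect_first (Q : Circuit (m + 1) H A B K)
    {R : Matrix (Input m H A) (Input m H A) ℂ} (hR : (Rᴴ * R).trace = 1) (i : Fin m) :
    1 - 2 * (1 - Q.passProbability (R * Rᴴ)) ≤
      (expect (Q.finalState R) (quad 1 (signAt i) 1 1)).re := by
  have h := two_mul_sum_le_expect_diagonal (Q.trace_arrangedState hR)
    (fun x => x.2.1 = ((fun _ => false, fun _ => false) : Tests m)) (fun x => x.2.1.1 i)
    fun x hx => by rw [hx]
  rw [← Q.passProbability_eq] at h
  rw [quad_signAt_first, ← expect_submatrix (Q.arrangeEquiv.trans (cellsEquiv m H A)),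
    Matrix.submatrix_diagonal_equiv]
  refine le_trans (by linarith) h

lemma Circuit.le_expect_second (Q : Circuit (m + 1) H A B K)
    {R : Matrix (Input m H A) (Input m H A) ℂ} (hR : (Rᴴ * R).trace = 1) (i : Fin m) :
    1 - 2 * (1 - Q.passProbability (R * Rᴴ)) ≤
      (expect (Q.finalState R) (quad 1 1 (signAt i) 1)).re := by
  have h := two_mul_sum_le_expect_diagonal (Q.trace_arrangedState hR)
    (fun x => x.2.1 = ((fun _ => false, fun _ => false) : Tests m)) (fun x => x.2.1.2 i)
    fun x hx => by rw [hx]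
  rw [← Q.passProbability_eq] at h
  rw [quad_signAt_second, ← expect_submatrix (Q.arrangeEquiv.trans (cellsEquiv m H A)),
    Matrix.submatrix_diagonal_equiv]
  refine le_trans (by linarith) h

/-- An observable on the output of the last piece, in terms of the final state of the cells. -/
lemma Circuit.trace_mul_trLeft_parallelRun (Q : Circuit (m + 1) H A B K)
    (R : Matrix (Input m H A) (Input m H A) ℂ) (S : Matrix K K ℂ) :
    (S * trLeft (Q.parallelRun (R * Rᴴ))).trace =
      expect (Q.finalState R) (onCell (Fin m) (Sum.inl (Fin.last m)) (Q.outputObservable S)) := by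
  rw [parallelRun_eq, trLeft_measureLeft, ← trace_one_kronecker_mul, ← trace_one_kronecker_mul,
    ← expect_eq_trace, arrangedState, ← expect_submatrix (Q.arrangeEquiv.trans (cellsEquiv m H A))]
  congr 1
  ext ⟨⟨c, V, b, T⟩, ⟨⟨t, u⟩, k⟩⟩ ⟨⟨c', V', b', T'⟩, ⟨⟨t', u'⟩, k'⟩⟩
  have hz : ∀ (c t u : Fin m → Bool) (V : Fin m → H × A) (b : B) (T : Fin m → H × A) (k : K),
      (Q.arrangeEquiv.trans (cellsEquiv m H A)) ((c, V, b, T), ((t, u), k)) =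
        (c, t, u, Sum.elim (Fin.snoc (α := fun _ => H × A) V (Q.split.symm (b, k))) T) :=
    fun _ _ _ _ _ _ _ => rfl
  have hcond : (∀ q : Fin (m + 1) ⊕ Fin m, q ≠ Sum.inl (Fin.last m) →
      Sum.elim (Fin.snoc (α := fun _ => H × A) V (Q.split.symm (b, k))) T q =
        Sum.elim (Fin.snoc (α := fun _ => H × A) V' (Q.split.symm (b', k'))) T' q) ↔
      V = V' ∧ T = T' := by
    constructor
    · refine fun hq => ⟨funext fun i => ?_, funext fun i => ?_⟩
      · simpa using hq (Sum.inl i.castSucc) (by simp [(Fin.castSucc_lt_last i).ne])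
      · simpa using hq (Sum.inr i) (by simp)
    · rintro ⟨rfl, rfl⟩ (j | i) hq
      · obtain ⟨i, rfl⟩ := Fin.exists_castSucc_eq.2 fun h0 : j = Fin.last m => hq (by rw [h0])
        simp
      · rfl
  simp only [Matrix.submatrix_apply, hz, onCell, quad_apply, atSite_apply, hcond, outputObservable,
    Sum.elim_inl, Fin.snoc_last, Equiv.apply_symm_apply, Matrix.kroneckerMap_apply,
    Matrix.one_apply, Prod.mk.injEq]
  by_cases hc : c = c'
  · by_cases ht : t = t'
    · by_cases hu : u = u'
      · by_cases hRT : V = V' ∧ T = T'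
        · by_cases hb : b = b' <;> simp [hc, ht, hu, hRT, hb]
        · have : ¬(V = V' ∧ b = b' ∧ T = T') := fun h => hRT ⟨h.1, h.2.2⟩
          simp only [hc, ht, hu, hRT, this, true_and, if_false, mul_zero, zero_mul]
      · simp [hu]
    · simp [ht]
  · simp [hc]

/-- The observable that the observable `O` on the output of the last piece turns into in front of
the piece `j`, when the pieces are run one after the other. -/
def Circuit.observableBefore (Q : Circuit (m + 1) H A B K) (O : Matrix (H × A) (H × A) ℂ) (j : ℕ) :
    Matrix (H × A) (H × A) ℂ :=
  pullback ((List.ofFn Q.U).drop j) O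

/-- The swap tests force the parallelized circuit to simulate the original one: if they are likely
to succeed, then the outputs of the two circuits nearly agree. -/
lemma Circuit.abs_trace_parallelRun_sub_run_le (Q : Circuit (m + 1) H A B K)
    {ρ : Matrix (Input m H A) (Input m H A) ℂ} (hρ : IsDensity ρ) {S : Matrix K K ℂ}
    (hS : IsReflection S) :
    |(S * trLeft (Q.parallelRun ρ)).trace.re - (S * Q.run (trRight ρ)).trace.re| ≤
      m * (12 * √(1 - Q.passProbability ρ)) := by
  obtain ⟨R, hR, rfl⟩ := exists_posSemidef_sqrt hρ.1
  have hRH : Rᴴ = R := hR.1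
  have htr : (Rᴴ * R).trace = 1 := by rw [hRH]; exact hρ.2
  have hsq : R * R = R * Rᴴ := by rw [hRH]
  rw [hsq]
  have ready := readyState_isReady Q.zero htr
  set e := 1 - Q.passProbability (R * Rᴴ) with he
  set O := Q.outputObservable S with hO
  have hrefl : IsReflection O := Q.outputObservable_isReflection hS
  set M := readyState Q.zero R with hM
  have hs : Function.Injective (Fin.succ : Fin m → Fin (m + 1)) := Fin.succ_injective m
  have hcs : Function.Injective (Fin.castSucc : Fin m → Fin (m + 1)) := Fin.castSucc_injective m
  -- the expectation of the pulled back observable at the output of the piece `j`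
  let y : Fin (m + 1) → ℝ := fun j =>
    (expect (firstTestsCells m H A * M)
      (onCell (Fin m) (Sum.inl j) (Q.observableBefore O j))).re
  have hy : ∀ j : Fin (m + 1), y j = (expect (Q.piecesCells *
      (firstTestsCells m H A * M))
        (onCell (Fin m) (Sum.inl j) (Q.observableBefore O (j + 1)))).re := fun j => by
    rw [expect_mul, flipAndPieces_conj_onCell Q.mats_isometry]
    simp only [y, observableBefore]
    rw [pullback_drop]
    rfl
  have step : ∀ i : Fin m, |y i.succ - y i.castSucc| ≤ 12 * √e := fun i => by
    have hfirst := Q.le_expect_first htr i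
    have hsecond := Q.le_expect_second htr i
    have hrefl' : IsReflection (Q.observableBefore O i.succ) := pullback_isReflection _ hrefl
    have h := ready.interface_le hs hcs Q.mats_isometry
      (i := i) (Fin.castSucc_lt_succ (i := i)).ne hfirst hsecond hrefl'
    rw [hy i.castSucc]
    exact h
  have chain : ∀ j : Fin (m + 1), |y j - y 0| ≤ j * (12 * √e) := fun j => by
    induction j using Fin.induction with
    | zero => simp
    | succ i ih =>
      have h := abs_sub_le (y i.succ) (y i.castSucc) (y 0)
      have h2 := step i
      simp only [Fin.val_castSucc, Fin.val_succ, Nat.cast_add, Nat.cast_one] at ih ⊢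
      linarith
  have hlast : (S * trLeft (Q.parallelRun (R * Rᴴ))).trace.re = y (Fin.last m) := by
    have hdrop : Q.observableBefore O (m + 1) = O := by
      rw [observableBefore, List.drop_of_length_le (by simp)]
      rfl
    rw [Q.trace_mul_trLeft_parallelRun, hy, Fin.val_last, hdrop, finalState, expect_mul,
      secondTests_conj_onCell_of_notMem hcs]
    rintro ⟨i, hi⟩
    exact (Fin.castSucc_lt_last i).ne hi
  have hzero : (S * Q.run (trRight (R * Rᴴ))).trace.re = y 0 := by
    simp only [y]
    rw [expect_mul, firstTests_conj_onCell_of_notMem hs (by simp), hM,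
      expect_readyState_onCell_zero, Q.trace_mul_run]
    rfl
  rw [hlast, hzero]
  simpa using chain (Fin.last m)

end Output

/-! ### Comparing the outputs of the two constructed circuits -/

section Compare

variable {T K E : Type*} [Fintype T] [DecidableEq T] [Fintype K] [DecidableEq K] [Fintype E]

lemma proj_single_apply (z x y : T) :
    proj (Pi.single z 1) x y = if x = z ∧ y = z then 1 else 0 := by
  simp only [proj, Matrix.vecMulVec_apply, Pi.single_apply, Pi.star_apply]
  by_cases hx : x = z <;> by_cases hy : y = z <;> simp [hx, hy]

lemma row_eq_zero {X : Type*} {M : Matrix X E ℂ} {x : X} (h : (M * Mᴴ) x x = 0) (j : E) :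
    M x j = 0 := by
  have h2 : M x ⬝ᵥ star (M x) = 0 := h
  exact congrFun (dotProduct_self_star_eq_zero.1 h2) j

variable {P R : Matrix (T × K) (T × K) ℂ} {z : T} {M N : Matrix (T × T × K) E ℂ}

/-- The dummy qubits of each circuit are in the state `z`, so only the part of the state of each
circuit in which its own tests have the outcome `z` contributes to the overlap. -/
lemma norm_trace_sq_le_of_aligned (hM : M * Mᴴ = proj (Pi.single z 1) ⊗ₖ P)
    (hN : N * Nᴴ = (proj (Pi.single z 1) ⊗ₖ R).submatrix
      (fun x => (x.2.1, x.1, x.2.2)) (fun x => (x.2.1, x.1, x.2.2))) :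
    ‖(Mᴴ * N).trace‖ ^ 2 ≤ (∑ k, (P (z, k) (z, k)).re) * ∑ k, (R (z, k) (z, k)).re := by
  have zeroM : ∀ x y k j, x ≠ z → M (x, y, k) j = 0 := fun x y k j hx => by
    refine row_eq_zero ?_ j
    rw [hM, Matrix.kroneckerMap_apply, proj_single_apply, if_neg fun h => hx h.1, zero_mul]
  have zeroN : ∀ x y k j, y ≠ z → N (x, y, k) j = 0 := fun x y k j hy => by
    refine row_eq_zero ?_ j
    rw [hN, Matrix.submatrix_apply, Matrix.kroneckerMap_apply, proj_single_apply,
      if_neg fun h => hy h.1, zero_mul]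
  set M' : Matrix K E ℂ := M.submatrix (fun k => (z, z, k)) id with hM'
  set N' : Matrix K E ℂ := N.submatrix (fun k => (z, z, k)) id with hN'
  have h1 : (Mᴴ * N).trace = (M'ᴴ * N').trace := by
    simp only [Matrix.trace, Matrix.diag, Matrix.mul_apply, Matrix.conjTranspose_apply,
      Fintype.sum_prod_type]
    refine Finset.sum_congr rfl fun j _ => ?_
    rw [Fintype.sum_eq_single z, Fintype.sum_eq_single z]
    · rfl
    · intro y hy
      exact Finset.sum_eq_zero fun k _ => by rw [zeroN _ _ _ _ hy, mul_zero]
    · intro x hx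
      exact Finset.sum_eq_zero fun y _ => Finset.sum_eq_zero fun k _ => by
        rw [zeroM _ _ _ _ hx, star_zero, zero_mul]
  have h2 : (M'ᴴ * M').trace.re = ∑ k, (P (z, k) (z, k)).re := by
    rw [Matrix.trace_mul_comm, Matrix.trace, Complex.re_sum]
    refine Finset.sum_congr rfl fun k _ => ?_
    have h : (M' * M'ᴴ) k k = (M * Mᴴ) (z, z, k) (z, z, k) := rfl
    rw [Matrix.diag_apply, h, hM, Matrix.kroneckerMap_apply, proj_single_apply, if_pos ⟨rfl, rfl⟩,
      one_mul]
  have h3 : (N'ᴴ * N').trace.re = ∑ k, (R (z, k) (z, k)).re := by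
    rw [Matrix.trace_mul_comm, Matrix.trace, Complex.re_sum]
    refine Finset.sum_congr rfl fun k _ => ?_
    have h : (N' * N'ᴴ) k k = (N * Nᴴ) (z, z, k) (z, z, k) := rfl
    rw [Matrix.diag_apply, h, hN, Matrix.submatrix_apply, Matrix.kroneckerMap_apply,
      proj_single_apply, if_pos ⟨rfl, rfl⟩, one_mul]
  rw [h1, ← h2, ← h3]
  exact norm_trace_conjTranspose_mul_sq_le M' N'

lemma trLeft_trLeft_left (z : T) (P : Matrix (T × K) (T × K) ℂ) :
    trLeft (trLeft (proj (Pi.single z 1) ⊗ₖ P)) = trLeft P := by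
  ext k k'
  simp [trLeft, Matrix.kroneckerMap_apply, proj_single_apply]

lemma trLeft_trLeft_right (z : T) (R : Matrix (T × K) (T × K) ℂ) :
    trLeft (trLeft ((proj (Pi.single z 1) ⊗ₖ R).submatrix
      (fun x : T × T × K => (x.2.1, x.1, x.2.2)) (fun x => (x.2.1, x.1, x.2.2)))) = trLeft R := by
  ext k k'
  simp only [trLeft, Matrix.submatrix_apply, Matrix.kroneckerMap_apply, proj_single_apply]
  rw [Finset.sum_comm]
  simp

lemma one_kronecker_isReflection {X Y : Type*} [Fintype X] [DecidableEq X] [Fintype Y]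
    [DecidableEq Y] {S : Matrix Y Y ℂ} (hS : IsReflection S) :
    IsReflection ((1 : Matrix X X ℂ) ⊗ₖ S) := by
  constructor
  · rw [Matrix.conjTranspose_kronecker, Matrix.conjTranspose_one, hS.conjTranspose_eq]
  · rw [← Matrix.mul_kronecker_mul, Matrix.one_mul, hS.mul_self, Matrix.one_kronecker_one]

/-- Purifications of large overlap have reduced states that are hard to distinguish. -/
lemma expect_sub_sq_le {X : Type*} [Fintype X] [DecidableEq X] {M N : Matrix X E ℂ}
    (hM : (Mᴴ * M).trace = 1) (hN : (Nᴴ * N).trace = 1) {O : Matrix X X ℂ}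
    (hO : IsReflection O) :
    ((expect M O).re - (expect N O).re) ^ 2 ≤ 4 * (1 - ‖(Mᴴ * N).trace‖ ^ 2) := by
  -- choose the phase of `N` such that the overlap is a nonnegative real number
  obtain ⟨c, hc, hz⟩ := RCLike.exists_norm_eq_mul_self (K := ℂ) (Mᴴ * N).trace
  have hcc : star c * c = 1 := by
    rw [mul_comm]
    have := RCLike.mul_conj c
    rw [hc] at this
    simpa using this
  have key := hO.sub_sq_le M (c • N)
  have h1 : ∀ A : Matrix X X ℂ, (c • N)ᴴ * A * (c • N) = Nᴴ * A * N := fun A => by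
    rw [Matrix.conjTranspose_smul, Matrix.smul_mul, Matrix.smul_mul, Matrix.mul_smul, smul_smul,
      hcc, one_smul]
  have h2 : ((c • N)ᴴ * (c • N)).trace = 1 := by
    have := h1 1
    rw [Matrix.mul_one, Matrix.mul_one] at this
    rw [this, hN]
  have h3 : (Mᴴ * (c • N)).trace.re = ‖(Mᴴ * N).trace‖ := by
    rw [Matrix.mul_smul, Matrix.trace_smul, smul_eq_mul, ← hz]
    simp
  rw [re_trace_sub_sq, re_trace_add_sq, h1, h2, h3, hM, Complex.one_re] at key
  calc _ ≤ _ := key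
    _ = _ := by ring

end Compare

section Final

variable {m : ℕ} {H A B K : Type*} [Fintype H] [DecidableEq H] [Fintype A] [DecidableEq A]
  [Fintype B] [Fintype K]

/-- The bound on the overlap of the outputs of the constructed circuits, in terms of the fidelity of
the outputs of the original circuits on the first part of the inputs. -/
lemma fidelity_constructed_le (Q₁ Q₂ : Circuit (m + 1) H A B K)
    {ρ ξ : Matrix (Input m H A) (Input m H A) ℂ} (hρ : IsDensity ρ) (hξ : IsDensity ξ)
    (hf : fidelity (Q₁.run (trRight ρ)) (Q₂.run (trRight ξ)) ≤ 1) :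
    fidelity (Q₁.constructed₁ ρ) (Q₂.constructed₂ ξ) ≤
      1 - (1 - fidelity (Q₁.run (trRight ρ)) (Q₂.run (trRight ξ))) ^ 2 /
        (144 * ((m + 1 : ℕ) : ℝ) ^ 2) := by
  classical
  set f := fidelity (Q₁.run (trRight ρ)) (Q₂.run (trRight ξ)) with hfdef
  have hf0 : 0 ≤ f := fidelity_nonneg _ _
  set n : ℝ := ((m + 1 : ℕ) : ℝ) with hn
  have hn1 : (1 : ℝ) ≤ n := by rw [hn]; exact_mod_cast Nat.le_add_left 1 m
  have hmn : (m : ℝ) = n - 1 := by rw [hn]; push_cast; ring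
  have hpos : 0 < 144 * n ^ 2 := by positivity
  refine fidelity_le ?_ fun d M N hM hN => ?_
  · rw [sub_nonneg, div_le_one hpos]
    nlinarith
  obtain ⟨S, hS, hSf⟩ := exists_reflection_fidelity
    (Q₁.run_isDensity (isDensity_trRight hρ)) (Q₂.run_isDensity (isDensity_trRight hξ))
  rw [← hfdef] at hSf
  have b1 := Q₁.abs_trace_parallelRun_sub_run_le hρ hS
  have b2 := Q₂.abs_trace_parallelRun_sub_run_le hξ hS
  have marg1 : ∀ S : Matrix K K ℂ, expect M
      ((1 : Matrix (Tests m) (Tests m) ℂ) ⊗ₖ ((1 : Matrix (Tests m) (Tests m) ℂ) ⊗ₖ S)) =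
      (S * trLeft (Q₁.parallelRun ρ)).trace := fun S => by
    rw [expect_eq_trace, hM, trace_one_kronecker_mul, trace_one_kronecker_mul,
      Circuit.constructed₁, dummies, trLeft_trLeft_left]
  have marg2 : ∀ S : Matrix K K ℂ, expect N
      ((1 : Matrix (Tests m) (Tests m) ℂ) ⊗ₖ ((1 : Matrix (Tests m) (Tests m) ℂ) ⊗ₖ S)) =
      (S * trLeft (Q₂.parallelRun ξ)).trace := fun S => by
    rw [expect_eq_trace, hN, trace_one_kronecker_mul, trace_one_kronecker_mul,
      Circuit.constructed₂, dummies, trLeft_trLeft_right]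
  have hp : ∀ (Q : Circuit (m + 1) H A B K) {σ : Matrix (Input m H A) (Input m H A) ℂ},
      IsDensity σ → Q.passProbability σ ≤ 1 ∧ 0 ≤ Q.passProbability σ ∧
        (trLeft (Q.parallelRun σ)).trace = 1 := by
    intro Q σ hσ
    obtain ⟨R, hR, rfl⟩ := exists_posSemidef_sqrt hσ.1
    have hRH : Rᴴ = R := hR.1
    have htr : (Rᴴ * R).trace = 1 := by rw [hRH]; exact hσ.2
    have hsq : R * R = R * Rᴴ := by rw [hRH]
    rw [hsq]
    refine ⟨Q.passProbability_le_one htr, Q.passProbability_nonneg R, ?_⟩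
    have h := trace_one_kronecker_mul (X := Tests m) (1 : Matrix K K ℂ)
      (trLeft (Q.arrangedState R * (Q.arrangedState R)ᴴ))
    have h' := trace_one_kronecker_mul (X := Discarded m H A B)
      (1 : Matrix (Tests m × K) (Tests m × K) ℂ) (Q.arrangedState R * (Q.arrangedState R)ᴴ)
    rw [Matrix.one_kronecker_one, Matrix.one_mul, Matrix.one_mul] at h h'
    rw [Q.parallelRun_eq, trLeft_measureLeft, ← h, ← h', Matrix.trace_mul_comm,
      Q.trace_arrangedState htr]
  have trM : (Mᴴ * M).trace = 1 := by
    have h := marg1 1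
    rwa [Matrix.one_kronecker_one, Matrix.one_kronecker_one, expect_one, Matrix.one_mul,
      (hp Q₁ hρ).2.2] at h
  have trN : (Nᴴ * N).trace = 1 := by
    have h := marg2 1
    rwa [Matrix.one_kronecker_one, Matrix.one_kronecker_one, expect_one, Matrix.one_mul,
      (hp Q₂ hξ).2.2] at h
  have b3 := expect_sub_sq_le trM trN (one_kronecker_isReflection (X := Tests m)
    (one_kronecker_isReflection (X := Tests m) hS))
  rw [marg1, marg2] at b3
  have b4 : ‖(Mᴴ * N).trace‖ ^ 2 ≤ Q₁.passProbability ρ * Q₂.passProbability ξ :=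
    norm_trace_sq_le_of_aligned hM hN
  have b5 := norm_trace_conjTranspose_mul_sq_le M N
  rw [trM, trN, Complex.one_re, one_mul] at b5
  set r := ‖(Mᴴ * N).trace‖ with hr
  have hr0 : 0 ≤ r := norm_nonneg _
  have hr1 : r ≤ 1 := by nlinarith
  set p₁ := Q₁.passProbability ρ with hp₁
  set p₂ := Q₂.passProbability ξ with hp₂
  have hp1 : p₁ ≤ 1 := (hp Q₁ hρ).1
  have hp2 : p₂ ≤ 1 := (hp Q₂ hξ).1
  have hp1' : 0 ≤ p₁ + p₂ := add_nonneg (hp Q₁ hρ).2.1 (hp Q₂ hξ).2.1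
  -- by the inequality of arithmetic and geometric means, `2 r ≤ p₁ + p₂`
  have hsum : 2 * r ≤ p₁ + p₂ := by
    refine abs_le_of_sq_le_sq' ?_ hp1' |>.2
    nlinarith [sq_nonneg (p₁ - p₂)]
  have e1 : √(1 - p₁) ^ 2 = 1 - p₁ := Real.sq_sqrt (by linarith)
  have e2 : √(1 - p₂) ^ 2 = 1 - p₂ := Real.sq_sqrt (by linarith)
  have e3 : √(1 - r) ^ 2 = 1 - r := Real.sq_sqrt (by linarith)
  have c1 : √(1 - p₁) + √(1 - p₂) ≤ 2 * √(1 - r) := by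
    refine abs_le_of_sq_le_sq' ?_ (by positivity) |>.2
    nlinarith [sq_nonneg (√(1 - p₁) - √(1 - p₂))]
  -- `4 (1 - r²) = 4 (1 + r) (1 - r) ≤ 9 (1 - r)`
  have h9 : 4 * (1 - r ^ 2) ≤ (3 * √(1 - r)) ^ 2 := by nlinarith
  have c2 := (abs_le.1 (abs_le_of_sq_le_sq (b3.trans h9) (by positivity))).2
  have c3 : 1 - f ≤ 12 * n * √(1 - r) := by
    have d1 := (abs_le.1 b1).1
    have d2 := (abs_le.1 b2).2
    have d3 := mul_le_mul_of_nonneg_left c1 (show (0 : ℝ) ≤ 12 * m by positivity)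
    rw [hmn] at d1 d2 d3
    nlinarith [Real.sqrt_nonneg (1 - r)]
  have c4 : (1 - f) ^ 2 ≤ 144 * n ^ 2 * (1 - r) := by
    have h := pow_le_pow_left₀ (by linarith) c3 2
    calc _ ≤ _ := h
      _ = 144 * n ^ 2 * √(1 - r) ^ 2 := by ring
      _ = _ := by rw [e3]
  rw [le_sub_comm, div_le_iff₀ hpos]
  linarith

end Final

end QCirc

end

theorem mainTheorem5 (m : ℕ) {H A B K : Type*}
    [Fintype H] [DecidableEq H] [Fintype A] [DecidableEq A] [Fintype B] [Fintype K]
    (Q₁ Q₂ : QCirc.Circuit (m + 1) H A B K) (c : ℝ) (hc : 0 ≤ c)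
    (hQ : ∀ ρ₀ ξ₀ : Matrix H H ℂ, QCirc.IsDensity ρ₀ → QCirc.IsDensity ξ₀ →
      QCirc.fidelity (Q₁.run ρ₀) (Q₂.run ξ₀) < 1 - c) :
    ∀ ρ ξ : Matrix (QCirc.Input m H A) (QCirc.Input m H A) ℂ,
      QCirc.IsDensity ρ → QCirc.IsDensity ξ →
        QCirc.fidelity (Q₁.constructed₁ ρ) (Q₂.constructed₂ ξ) <
          1 - c ^ 2 / (144 * ((m + 1 : ℕ) : ℝ) ^ 2) := by
  intro ρ ξ hρ hξ
  have h := hQ _ _ (QCirc.isDensity_trRight hρ) (QCirc.isDensity_trRight hξ)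
  refine (QCirc.fidelity_constructed_le Q₁ Q₂ hρ hξ (by linarith)).trans_lt ?_
  have hpos : (0 : ℝ) < 144 * ((m + 1 : ℕ) : ℝ) ^ 2 := by positivity
  have h2 := pow_lt_pow_left₀ (show c < 1 - QCirc.fidelity (Q₁.run (QCirc.trRight ρ))
    (Q₂.run (QCirc.trRight ξ)) by linarith) hc two_ne_zero
  have h3 := div_lt_div_of_pos_right h2 hpos
  linarith
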